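/- Let $\Omega\subset\mathbb C^n$ be a bounded domain (open, connected, non-empty) with smooth boundary, let $r$ be a smooth defining function of $\Omega$, i.e. $r$ is a real-valued $C^\infty$ function on an open neighbourhood $U$ of $\overline\Omega$ with $\Omega=\{z\in U: r(z)<0\}$, and with $r=0$ and $dr\neq0$ at every point of $\partial\Omega$. Let $\epsilon>0$. Then there is a constant $C\ge 0$, depending only on $\Omega$, $r$ and $\epsilon$, such that the following holds for every plurisubharmonic function $u:\Omega\to[-\infty,\infty)$, $u\not\equiv-\infty$ (in particular for the bounded plurisubharmonic solution $u$ of a Dirichlet problem $(dd^cu)^n=f\,dV$ in $\Omega$, $u=\varphi$ on $\partial\Omega$). The function $u$ has a Riesz measure $\Delta u$ on $\Omega$, that is, $u$ is locally integrable on $\Omega$ and there is a positive Borel measure $\Delta u$ on $\Omega$, finite on compact subsets of $\Omega$, with $\int_\Omega\phi\,d(\Delta u)=\int_\Omega u\,\Delta\phi\,dV$ for all $\phi\in C^\infty_c(\Omega)$; and $$\int_\Omega(-r)^{1+\epsilon}\,d(\Delta u)\;\le\;C\int_\Omega(-r)^{-1+\epsilon}\,|u|\,dV ,$$ where both sides are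 understood in $[0,\infty]$. In other words, $\|(-r)^{1+\epsilon}\Delta u\|^\Omega\lesssim\|(-r)^{-1+\epsilon}u\|_{L^1(\Omega)}$, where $\|\cdot\|^{\Omega}$ denotes total mass on $\Omega$; in particular the left side is finite whenever the right side is. -/

import Mathlib

open MeasureTheory Set
open scoped ENNReal NNReal ContDiff

noncomputable section

/-- `r` is a smooth defining function of the open set `Ω ⊆ ℂⁿ`: it is `C^∞` (in the real sense) on an
open neighbourhood `U` of the closure of `Ω`, `Ω = {z ∈ U | r z < 0}`, and on the boundary of `Ω` the
function `r` vanishes and its differential does not. -/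
def IsSmoothDefiningFunction {n : ℕ} (Ω : Set (EuclideanSpace ℂ (Fin n)))
    (r : EuclideanSpace ℂ (Fin n) → ℝ) : Prop :=
  ∃ U : Set (EuclideanSpace ℂ (Fin n)), IsOpen U ∧ closure Ω ⊆ U ∧ ContDiffOn ℝ ∞ r U ∧
    Ω = {z ∈ U | r z < 0} ∧ ∀ z ∈ frontier Ω, r z = 0 ∧ fderiv ℝ r z ≠ 0

/-- The mean over the angle `θ ∈ (0, 2π]` of an extended-real function `v` that is bounded above: the
mean of the positive part (finite) minus the mean of the negative part (possibly `+∞`). -/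
def angularMean (v : ℝ → EReal) : EReal :=
  ((⨍⁻ θ in Ioc (0 : ℝ) (2 * Real.pi), (v θ).toENNReal ∂volume : ℝ≥0∞) : EReal) -
    ((⨍⁻ θ in Ioc (0 : ℝ) (2 * Real.pi), (-v θ).toENNReal ∂volume : ℝ≥0∞) : EReal)

/-- `u : Ω → [-∞, ∞)` is plurisubharmonic: it is upper semicontinuous and has the sub-mean value
property on every closed disc `{a + ζ b | |ζ| ≤ 1}` of a complex line that lies in `Ω`. (The function
that is identically `-∞` is not excluded here. The values of `u` outside `Ω` are irrelevant.) -/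
structure IsPlurisubharmonicOn {n : ℕ} (u : EuclideanSpace ℂ (Fin n) → EReal)
    (Ω : Set (EuclideanSpace ℂ (Fin n))) : Prop where
  lt_top : ∀ z ∈ Ω, u z < ⊤
  upperSemicontinuousOn : UpperSemicontinuousOn u Ω
  le_mean : ∀ a b : EuclideanSpace ℂ (Fin n), (∀ ζ : ℂ, ‖ζ‖ ≤ 1 → a + ζ • b ∈ Ω) →
    u a ≤ angularMean fun θ => u (a + Complex.exp (θ * Complex.I) • b)

/-- `μ` is the Riesz measure `Δu` of `u` on the open set `Ω`: `u` is locally integrable on `Ω`, `μ` is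
a positive Borel measure on `Ω` (extended by zero) that is finite on the compact subsets of `Ω`, and
`μ` is the Laplacian of `u` in the sense of distributions, `∫ φ dμ = ∫ u Δφ dV` for every real test
function `φ ∈ C_c^∞(Ω)`. Here `Δ` is the Laplacian of `ℂⁿ = ℝ²ⁿ`. A locally integrable `u` is finite
almost everywhere, and its values enter the integrals as real numbers. -/
structure IsRieszMeasure {n : ℕ} (Ω : Set (EuclideanSpace ℂ (Fin n)))
    (u : EuclideanSpace ℂ (Fin n) → EReal) (μ : Measure (EuclideanSpace ℂ (Fin n))) : Prop where
  ae_finite : ∀ᵐ z ∂volume, z ∈ Ω → u z ≠ ⊥ ∧ u z ≠ ⊤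
  locallyIntegrableOn : LocallyIntegrableOn (fun z => (u z).toReal) Ω volume
  compl_eq_zero : μ Ωᶜ = 0
  lt_top_of_isCompact : ∀ K ⊆ Ω, IsCompact K → μ K < ⊤
  integral_eq : ∀ φ : EuclideanSpace ℂ (Fin n) → ℝ, ContDiff ℝ ∞ φ → HasCompactSupport φ →
    tsupport φ ⊆ Ω →
      ∫ z, φ z ∂μ = ∫ z in Ω, (u z).toReal * (Laplacian.laplacian φ : _ → ℝ) z

end

/-!
The weighted estimate is the defining identity `∫ φ dμ = ∫ u Δφ dV` of the Riesz measure, applied to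
smooth cut-offs `φ = g (-r)` of the weight `(-r) ^ (1 + ε)`, where `g t` vanishes for `t ≤ δ` and
equals `t ^ (1 + ε)` for `t ≥ 2 δ`. Since `r = 0` on the boundary, `φ` has compact support in `Ω`.
Choosing `g` as a rescaling of a single profile gives `|g' t| ≲ t ^ ε` and `|g'' t| ≲ t ^ (-1 + ε)`
with constants independent of `δ` (`exists_smooth_cutoff_rpow`). As the first two derivatives of `r`
are bounded on the compact closure of `Ω`, it follows that `|Δφ| ≲ (-r) ^ (-1 + ε)` uniformly in `δ`
(`IsSmoothDefiningFunction.exists_test_functions`), and Fatou's lemma removes the cut-off.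

The existence of the Riesz measure is proved in three steps.

* Local integrability (`IsPlurisubharmonicOn.exists_lintegral_neg_lt_top`): averaging the sub-mean
  value property over all complex directions gives the one over balls, so `u` is integrable on every
  ball around a point where it is finite. The set of points near which `u` is integrable is thus
  nonempty, open and relatively closed, hence all of the connected set `Ω`.
* Positivity of the distribution `Δu` (`IsPlurisubharmonicOn.integral_mul_laplacian_nonneg`): for a
  test function `φ ≥ 0`, moving circle means from `φ` to `u` shows that `∫ u (A_t φ - φ) ≥ 0`, where
  `A_t φ` is the mean over circles of radius `t` in a complex line. By Taylor's formula
  `(A_t φ - φ) / t ^ 2` converges boundedly to a quarter of the Laplacian of `φ` along that line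
  (`tendsto_circleMean_sub_div`), and `Δ` is the sum of the Laplacians along the coordinate lines.
* A positive distribution is a measure (`exists_measure_of_positive_distribution`), by the M. Riesz
  extension theorem and the Riesz–Markov–Kakutani theorem.

Throughout, `u` is handled through the nonnegative function `M - u`, where `M` is a local upper
bound, so that Tonelli's theorem applies without integrability assumptions.
-/

open Filter Topology

/-! ### The mean value property and local integrability -/

lemma EReal.toENNReal_coe_sub_add_toENNReal {M : ℝ≥0} {x : EReal} (hx : x ≤ ((M : ℝ) : EReal)) :
    (((M : ℝ) : EReal) - x).toENNReal + x.toENNReal = M + (-x).toENNReal := by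
  induction x with
  | bot => simp
  | top => simp at hx
  | coe x =>
    have hx' : x ≤ M := by exact_mod_cast hx
    rw [← EReal.coe_sub, ← EReal.coe_neg, EReal.toENNReal_of_ne_top (EReal.coe_ne_top _),
      EReal.toENNReal_of_ne_top (EReal.coe_ne_top _), EReal.toENNReal_of_ne_top (EReal.coe_ne_top _)]
    simp only [EReal.toReal_coe]
    rw [← ENNReal.ofReal_coe_nnreal]
    rcases le_total 0 x with h | h
    · rw [ENNReal.ofReal_of_nonpos (by linarith : -x ≤ 0), add_zero,
        ← ENNReal.ofReal_add (by linarith) h]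
      simp
    · rw [ENNReal.ofReal_of_nonpos h, add_zero, sub_eq_add_neg,
        ENNReal.ofReal_add M.coe_nonneg (by linarith)]

lemma volume_restrict_Ioc_two_pi_ne_zero :
    volume.restrict (Ioc (0 : ℝ) (2 * Real.pi)) ≠ 0 := by
  intro h
  rw [Measure.restrict_eq_zero, Real.volume_Ioc] at h
  have := Real.pi_pos
  simp at h; linarith

/-- If `v ≤ M` then a lower bound `c` of the angular mean of `v` turns into an upper bound `M - c` of
the angular mean of the nonnegative function `M - v`, which is an honest Lebesgue integral. -/
lemma laverage_toENNReal_sub_le {v : ℝ → EReal} (hv : Measurable v) {M : ℝ≥0}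
    (hM : ∀ θ, v θ ≤ ((M : ℝ) : EReal)) {c : EReal} (hc : c ≤ angularMean v) :
    ⨍⁻ θ in Ioc (0 : ℝ) (2 * Real.pi), (((M : ℝ) : EReal) - v θ).toENNReal ∂volume ≤
      (((M : ℝ) : EReal) - c).toENNReal := by
  have : NeZero (volume.restrict (Ioc (0 : ℝ) (2 * Real.pi))) :=
    ⟨volume_restrict_Ioc_two_pi_ne_zero⟩
  unfold angularMean at hc
  set P := ⨍⁻ θ in Ioc (0 : ℝ) (2 * Real.pi), (v θ).toENNReal ∂volume with hP
  set N := ⨍⁻ θ in Ioc (0 : ℝ) (2 * Real.pi), (-v θ).toENNReal ∂volume with hN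
  set A := ⨍⁻ θ in Ioc (0 : ℝ) (2 * Real.pi), (((M : ℝ) : EReal) - v θ).toENNReal ∂volume with hA
  have hPM : P ≤ M := by
    calc P ≤ ⨍⁻ θ in Ioc (0 : ℝ) (2 * Real.pi), (M : ℝ≥0∞) ∂volume := by
          rw [hP]
          simp only [laverage]
          refine lintegral_mono fun θ => ?_
          have := EReal.toENNReal_le_toENNReal (hM θ)
          simpa using this
      _ = M := laverage_const _ _
  have hsum : A + P = M + N := by
    have h1 : A + P = ⨍⁻ θ in Ioc (0 : ℝ) (2 * Real.pi),
        ((((M : ℝ) : EReal) - v θ).toENNReal + (v θ).toENNReal) ∂volume := by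
      rw [hA, hP]
      simp only [laverage]
      rw [lintegral_add_right _ hv.ereal_toENNReal]
    have h2 : (M : ℝ≥0∞) + N = ⨍⁻ θ in Ioc (0 : ℝ) (2 * Real.pi),
        ((M : ℝ≥0∞) + (-v θ).toENNReal) ∂volume := by
      have h3 : (M : ℝ≥0∞) = ⨍⁻ θ in Ioc (0 : ℝ) (2 * Real.pi), (M : ℝ≥0∞) ∂volume :=
        (laverage_const _ _).symm
      conv_lhs => rw [h3]
      rw [hN]
      simp only [laverage]
      rw [lintegral_add_left measurable_const]
    rw [h1, h2]
    congr 1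
    funext θ
    exact EReal.toENNReal_coe_sub_add_toENNReal (hM θ)
  have hPtop : P ≠ ⊤ := (hPM.trans_lt ENNReal.coe_lt_top).ne
  by_cases hNtop : N = ⊤
  · rw [hNtop] at hc
    have : c = ⊥ := by
      simpa [sub_eq_add_neg] using hc
    simp [this]
  have hAtop : A ≠ ⊤ := by
    intro h
    rw [h, top_add] at hsum
    exact (ENNReal.add_ne_top.2 ⟨ENNReal.coe_ne_top, hNtop⟩) hsum.symm
  lift P to ℝ≥0 using hPtop with P'
  lift N to ℝ≥0 using hNtop with N'
  lift A to ℝ≥0 using hAtop with A'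
  have hs : (A' : ℝ) + P' = M + N' := by exact_mod_cast hsum
  induction c with
  | bot => simp
  | top =>
    exfalso
    have : ((P' : ℝ≥0∞) : EReal) - ((N' : ℝ≥0∞) : EReal) = (((P' : ℝ) - N' : ℝ) : EReal) := by
      rfl
    rw [this] at hc
    exact EReal.coe_ne_top _ (top_le_iff.1 hc)
  | coe c =>
    have : ((P' : ℝ≥0∞) : EReal) - ((N' : ℝ≥0∞) : EReal) = (((P' : ℝ) - N' : ℝ) : EReal) := by
      rfl
    rw [this] at hc
    have hc' : c ≤ P' - N' := by exact_mod_cast hc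
    rw [← EReal.coe_sub, EReal.toENNReal_of_ne_top (EReal.coe_ne_top _), EReal.toReal_coe,
      ← ENNReal.ofReal_coe_nnreal]
    exact ENNReal.ofReal_le_ofReal (by linarith)

section LocalIntegrability

variable {n : ℕ} {Ω : Set (EuclideanSpace ℂ (Fin n))} {u : EuclideanSpace ℂ (Fin n) → EReal}

/-- On an open set, the extension of an upper semicontinuous function by `⊤` is upper semicontinuous;
so the values outside `Ω` can be changed so as to make `u` globally Borel. -/
lemma UpperSemicontinuousOn.measurable_ite_top [DecidablePred (· ∈ Ω)]
    (hu : UpperSemicontinuousOn u Ω) (hΩ : IsOpen Ω) :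
    Measurable fun z => if z ∈ Ω then u z else ⊤ := by
  refine UpperSemicontinuous.measurable ?_
  intro z c hc
  by_cases hz : z ∈ Ω
  · simp only [hz, if_true] at hc
    have := hu z hz c hc
    rw [hΩ.nhdsWithin_eq hz] at this
    filter_upwards [this, hΩ.mem_nhds hz] with w hw hwΩ
    simpa [hwΩ] using hw
  · simp [hz] at hc

lemma IsPlurisubharmonicOn.congr {v : EuclideanSpace ℂ (Fin n) → EReal}
    (hu : IsPlurisubharmonicOn u Ω) (h : EqOn u v Ω) : IsPlurisubharmonicOn v Ω where
  lt_top z hz := h hz ▸ hu.lt_top z hz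
  upperSemicontinuousOn := by
    intro z hz c hc
    have := hu.upperSemicontinuousOn z hz c (by simpa only [h hz] using hc)
    filter_upwards [this, self_mem_nhdsWithin] with w hw hwΩ
    rwa [← h hwΩ]
  le_mean a b hab := by
    have h1 := hu.le_mean a b hab
    have h2 : (fun θ : ℝ => u (a + Complex.exp (θ * Complex.I) • b)) =
        fun θ : ℝ => v (a + Complex.exp (θ * Complex.I) • b) := by
      funext θ
      exact h (hab _ (Complex.norm_exp_ofReal_mul_I θ).le)
    rwa [h2, h (by simpa using hab 0 (by simp))] at h1

lemma IsPlurisubharmonicOn.exists_le_of_isCompact (hu : IsPlurisubharmonicOn u Ω)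
    {K : Set (EuclideanSpace ℂ (Fin n))} (hK : IsCompact K) (hKΩ : K ⊆ Ω) :
    ∃ M : ℝ≥0, ∀ z ∈ K, u z ≤ ((M : ℝ) : EReal) := by
  rcases K.eq_empty_or_nonempty with rfl | hne
  · exact ⟨0, by simp⟩
  obtain ⟨a, haK, ha⟩ := UpperSemicontinuousOn.exists_isMaxOn hne hK
    (hu.upperSemicontinuousOn.mono hKΩ)
  refine ⟨(u a).toReal.toNNReal, fun z hz => (ha hz).trans ?_⟩
  have h1 := EReal.le_coe_toReal (hu.lt_top a (hKΩ haK)).ne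
  refine h1.trans ?_
  exact_mod_cast Real.le_coe_toNNReal _

/-- The sub-mean value property of `u`, as a super-mean value property of `M - u ≥ 0`. -/
lemma IsPlurisubharmonicOn.laverage_le (hu : IsPlurisubharmonicOn u Ω) (hum : Measurable u)
    {M : ℝ≥0} {a b : EuclideanSpace ℂ (Fin n)} (hab : ∀ ζ : ℂ, ‖ζ‖ ≤ 1 → a + ζ • b ∈ Ω)
    (hM : ∀ ζ : ℂ, ‖ζ‖ ≤ 1 → u (a + ζ • b) ≤ ((M : ℝ) : EReal)) :
    ⨍⁻ θ in Ioc (0 : ℝ) (2 * Real.pi),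
      (((M : ℝ) : EReal) - u (a + Complex.exp (θ * Complex.I) • b)).toENNReal ∂volume ≤
        (((M : ℝ) : EReal) - u a).toENNReal :=
  laverage_toENNReal_sub_le (hum.comp (by fun_prop))
    (fun θ => hM _ (Complex.norm_exp_ofReal_mul_I θ).le) (hu.le_mean a b hab)

/-- Integrating the super-mean value property over the directions `b` gives the one over balls,
because the rotations `b ↦ e^{iθ} b` preserve the volume. -/
lemma IsPlurisubharmonicOn.lintegral_ball_le (hu : IsPlurisubharmonicOn u Ω) (hum : Measurable u)
    {M : ℝ≥0} {a : EuclideanSpace ℂ (Fin n)} {R : ℝ} (hR : Metric.ball a R ⊆ Ω)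
    (hM : ∀ z ∈ Metric.ball a R, u z ≤ ((M : ℝ) : EReal)) :
    ∫⁻ z in Metric.ball a R, (((M : ℝ) : EReal) - u z).toENNReal ≤
      (((M : ℝ) : EReal) - u a).toENNReal * volume (Metric.ball a R) := by
  have : NeZero (volume.restrict (Ioc (0 : ℝ) (2 * Real.pi))) :=
    ⟨volume_restrict_Ioc_two_pi_ne_zero⟩
  set V : EuclideanSpace ℂ (Fin n) → ℝ≥0∞ := fun z => (((M : ℝ) : EReal) - u z).toENNReal with hV
  have hVm : Measurable V := (measurable_const.sub hum).ereal_toENNReal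
  set B := Metric.ball (0 : EuclideanSpace ℂ (Fin n)) R with hB
  have htrans : ∫⁻ z in Metric.ball a R, V z = ∫⁻ b in B, V (a + b) := by
    have h := (measurePreserving_add_left volume a).setLIntegral_comp_preimage
      (measurableSet_ball (x := a) (ε := R)) hVm
    rw [← h]
    congr 2
    ext b; simp [hB]
  have hrot : ∀ θ : ℝ, ∫⁻ b in B, V (a + Complex.exp (θ * Complex.I) • b) =
      ∫⁻ b in B, V (a + b) := by
    intro θ
    have hnorm := Complex.norm_exp_ofReal_mul_I θ
    have hne : Complex.exp (θ * Complex.I) ≠ 0 := Complex.exp_ne_zero _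
    let e : EuclideanSpace ℂ (Fin n) ≃ₗᵢ[ℝ] EuclideanSpace ℂ (Fin n) :=
      { toLinearEquiv := (LinearEquiv.smulOfNeZero ℂ (EuclideanSpace ℂ (Fin n)) _ hne).restrictScalars ℝ
        norm_map' := fun b => by
          change ‖Complex.exp (θ * Complex.I) • b‖ = ‖b‖
          rw [norm_smul, hnorm, one_mul] }
    have h := (LinearIsometryEquiv.measurePreserving e).setLIntegral_comp_preimage
      (measurableSet_ball (x := (0 : EuclideanSpace ℂ (Fin n))) (ε := R))
      (hVm.comp (measurable_const_add a))
    rw [← hB] at h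
    have hpre : e ⁻¹' B = B := by
      ext b
      simp [hB]
    rw [hpre] at h
    exact h
  have hswap : ∫⁻ b in B, ⨍⁻ θ in Ioc (0 : ℝ) (2 * Real.pi),
      V (a + Complex.exp (θ * Complex.I) • b) ∂volume = ∫⁻ b in B, V (a + b) := by
    simp only [laverage]
    rw [lintegral_lintegral_swap]
    · simp_rw [hrot]
      exact laverage_const _ _
    · exact (hVm.comp (by fun_prop)).aemeasurable
  calc ∫⁻ z in Metric.ball a R, V z = ∫⁻ b in B, V (a + b) := htrans
    _ = ∫⁻ b in B, ⨍⁻ θ in Ioc (0 : ℝ) (2 * Real.pi),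
      V (a + Complex.exp (θ * Complex.I) • b) ∂volume := hswap.symm
    _ ≤ ∫⁻ b in B, V a := by
      refine setLIntegral_mono measurable_const fun b hb => ?_
      have hmem : ∀ ζ : ℂ, ‖ζ‖ ≤ 1 → a + ζ • b ∈ Metric.ball a R := by
        intro ζ hζ
        have hb' : ‖b‖ < R := by simpa [hB] using hb
        simp only [Metric.mem_ball, dist_self_add_left, norm_smul]
        nlinarith [norm_nonneg b, norm_nonneg ζ]
      exact hu.laverage_le hum (fun ζ hζ => hR (hmem ζ hζ)) (fun ζ hζ => hM _ (hmem ζ hζ))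
    _ = V a * volume (Metric.ball a R) := by
      rw [setLIntegral_const, hB, Measure.addHaar_ball_center volume a]

lemma EReal.toENNReal_neg_le_coe_sub (M : ℝ≥0) (x : EReal) :
    (-x).toENNReal ≤ (((M : ℝ) : EReal) - x).toENNReal := by
  refine EReal.toENNReal_le_toENNReal ?_
  rw [sub_eq_add_neg]
  have : (0 : EReal) + -x ≤ ((M : ℝ) : EReal) + -x :=
    add_le_add_left (by exact_mod_cast M.2) _
  simpa using this

/-- A plurisubharmonic function that is not identically `-⊤` on a domain has a locally integrable
negative part: the set of points near which it is integrable is open, and it is closed in the domain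
by the mean value property over balls. -/
lemma IsPlurisubharmonicOn.exists_lintegral_neg_lt_top (hu : IsPlurisubharmonicOn u Ω)
    (hum : Measurable u) (hΩ : IsOpen Ω) (hconn : IsPreconnected Ω) (hne : ∃ z ∈ Ω, u z ≠ ⊥) :
    ∀ z ∈ Ω, ∃ ρ > 0, ∫⁻ w in Metric.ball z ρ, (-u w).toENNReal < ⊤ := by
  -- A point where `u` is finite is the centre of balls of controlled size on which `u` is integrable.
  have key : ∀ a ∈ Ω, u a ≠ ⊥ → ∀ R : ℝ, Metric.closedBall a R ⊆ Ω →
      ∫⁻ w in Metric.ball a R, (-u w).toENNReal < ⊤ := by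
    intro a ha hua R hR
    obtain ⟨M, hM⟩ := hu.exists_le_of_isCompact (isCompact_closedBall a R) hR
    have h := hu.lintegral_ball_le hum (Metric.ball_subset_closedBall.trans hR)
      (fun z hz => hM z (Metric.ball_subset_closedBall hz))
    refine (lintegral_mono fun w => EReal.toENNReal_neg_le_coe_sub M (u w)).trans_lt
      (h.trans_lt (ENNReal.mul_lt_top ?_ measure_ball_lt_top))
    have hut := hu.lt_top a ha
    generalize u a = x at hua hut
    induction x with
    | bot => exact absurd rfl hua
    | top => exact absurd hut (lt_irrefl _)
    | coe x =>
      rw [← EReal.coe_sub, EReal.toENNReal_of_ne_top (EReal.coe_ne_top _)]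
      exact ENNReal.ofReal_lt_top
  set G : Set (EuclideanSpace ℂ (Fin n)) :=
    {z | ∃ ρ > 0, ∫⁻ w in Metric.ball z ρ, (-u w).toENNReal < ⊤} with hG
  have hGo : IsOpen G := by
    rw [Metric.isOpen_iff]
    rintro z ⟨ρ, hρ, hz⟩
    refine ⟨ρ / 2, by positivity, fun w hw => ⟨ρ / 2, by positivity, ?_⟩⟩
    refine (lintegral_mono_set ?_).trans_lt hz
    exact Metric.ball_subset_ball' (by have := Metric.mem_ball.1 hw; linarith)
  refine IsPreconnected.subset_of_closure_inter_subset hconn hGo ?_ ?_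
  · obtain ⟨a, ha, hua⟩ := hne
    obtain ⟨R, hR, hRΩ⟩ := Metric.nhds_basis_closedBall.mem_iff.1 (hΩ.mem_nhds ha)
    exact ⟨a, ha, R, hR, key a ha hua R hRΩ⟩
  · rintro z ⟨hzG, hzΩ⟩
    obtain ⟨R, hR, hRΩ⟩ := Metric.nhds_basis_closedBall.mem_iff.1 (hΩ.mem_nhds hzΩ)
    obtain ⟨w, ⟨ρ, hρ, hwρ⟩, hwz⟩ := Metric.mem_closure_iff.1 hzG (R / 8) (by positivity)
    -- `u` is finite almost everywhere near `w`, hence somewhere near `w`.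
    have : ∃ a ∈ Metric.ball w (min ρ (R / 8)), u a ≠ ⊥ := by
      by_contra! hcon
      have h1 : ∫⁻ x in Metric.ball w (min ρ (R / 8)), (-u x).toENNReal = ⊤ := by
        rw [setLIntegral_congr_fun (g := fun _ => ⊤) measurableSet_ball
          (fun x hx => by simp [hcon x hx]), setLIntegral_const, ENNReal.top_mul]
        exact (Metric.measure_ball_pos volume w (by positivity)).ne'
      have h2 := (lintegral_mono_set (μ := volume) (f := fun x => (-u x).toENNReal)
        (Metric.ball_subset_ball (x := w) (min_le_left ρ (R / 8)))).trans_lt hwρ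
      exact h2.ne h1
    obtain ⟨a, haw, hua⟩ := this
    have haw' : dist a w < R / 8 := (Metric.mem_ball.1 haw).trans_le (min_le_right _ _)
    have haz : dist a z < R / 4 := by
      have := dist_triangle a w z
      rw [dist_comm z w] at hwz
      linarith
    have hsub : Metric.closedBall a (R / 2) ⊆ Ω :=
      (Metric.closedBall_subset_closedBall' (by linarith)).trans hRΩ
    refine ⟨R / 4, by positivity, (lintegral_mono_set ?_).trans_lt
      (key a (hsub (Metric.mem_closedBall_self (by positivity))) hua (R / 2) hsub)⟩
    exact Metric.ball_subset_ball' (by rw [dist_comm]; linarith)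

end LocalIntegrability

/-! ### Second-order Taylor expansion and circle means -/

section SecondOrder

variable {E : Type*} [NormedAddCommGroup E] [NormedSpace ℝ E] {φ : E → ℝ}

lemma hasDerivAt_comp_add_smul {z v : E} {s : ℝ} (hφ : ContDiff ℝ 1 φ) :
    HasDerivAt (fun s : ℝ => φ (z + s • v)) (fderiv ℝ φ (z + s • v) v) s := by
  have h1 : HasDerivAt (fun s : ℝ => z + s • v) v s := by
    simpa using ((hasDerivAt_id s).smul_const v).const_add z
  exact ((hφ.differentiable one_ne_zero) _).hasFDerivAt.comp_hasDerivAt s h1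

/-- First-order Taylor formula with a quadratic bound, uniform in the base point. -/
lemma exists_abs_sub_sub_fderiv_le (hφ : ContDiff ℝ 2 φ) (hc : HasCompactSupport φ) :
    ∃ M : ℝ, 0 ≤ M ∧ ∀ z v : E, |φ (z + v) - φ z - fderiv ℝ φ z v| ≤ M * ‖v‖ ^ 2 := by
  obtain ⟨L, hL⟩ := ContDiff.lipschitzWith_of_hasCompactSupport (𝕂 := ℝ) (n := 1)
    (hc.fderiv (𝕜 := ℝ)) (hφ.fderiv_right (m := 1) (by norm_num)) one_ne_zero
  refine ⟨L, L.2, fun z v => ?_⟩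
  have hd : ∀ s ∈ Icc (0 : ℝ) 1, HasDerivWithinAt
      (fun s : ℝ => φ (z + s • v) - s * fderiv ℝ φ z v)
      (fderiv ℝ φ (z + s • v) v - fderiv ℝ φ z v) (Icc 0 1) s := by
    intro s _
    have h2 := (hasDerivAt_id s).mul_const (fderiv ℝ φ z v)
    rw [one_mul] at h2
    exact ((hasDerivAt_comp_add_smul (hφ.of_le one_le_two)).sub h2).hasDerivWithinAt
  have hb : ∀ s ∈ Ico (0 : ℝ) 1, ‖fderiv ℝ φ (z + s • v) v - fderiv ℝ φ z v‖ ≤ L * ‖v‖ ^ 2 := by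
    intro s hs
    rw [← sub_apply]
    refine (ContinuousLinearMap.le_opNorm _ _).trans ?_
    have h3 := hL.dist_le_mul (z + s • v) z
    rw [dist_eq_norm, dist_self_add_left, norm_smul, Real.norm_of_nonneg hs.1] at h3
    have h4 : (L : ℝ) * (s * ‖v‖) ≤ L * ‖v‖ := by
      refine mul_le_mul_of_nonneg_left ?_ L.2
      exact mul_le_of_le_one_left (norm_nonneg v) hs.2.le
    calc _ ≤ (L * ‖v‖) * ‖v‖ := mul_le_mul_of_nonneg_right (h3.trans h4) (norm_nonneg v)
      _ = _ := by ring
  have := norm_image_sub_le_of_norm_deriv_le_segment_01' hd hb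
  simpa [Real.norm_eq_abs, sub_right_comm] using this

lemma tendsto_taylor_two (hφ : ContDiff ℝ 2 φ) (z v : E) :
    Tendsto (fun t : ℝ => (φ (z + t • v) - φ z - t * fderiv ℝ φ z v) / t ^ 2) (𝓝[>] 0)
      (𝓝 (fderiv ℝ (fderiv ℝ φ) z v v / 2)) := by
  have hcont : Continuous φ := hφ.continuous
  have hd2 : HasDerivAt (fun t : ℝ => fderiv ℝ φ (z + t • v) v) (fderiv ℝ (fderiv ℝ φ) z v v) 0 := by
    have h1 : HasDerivAt (fun s : ℝ => z + s • v) v 0 := by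
      simpa using ((hasDerivAt_id (0 : ℝ)).smul_const v).const_add z
    have h2 : DifferentiableAt ℝ (fderiv ℝ φ) (z + (0 : ℝ) • v) :=
      (hφ.fderiv_right (m := 1) (by norm_num)).differentiable one_ne_zero _
    have h3 : HasDerivAt (fun t : ℝ => fderiv ℝ φ (z + t • v))
        (fderiv ℝ (fderiv ℝ φ) (z + (0 : ℝ) • v) v) 0 :=
      HasFDerivAt.comp_hasDerivAt (0 : ℝ) h2.hasFDerivAt h1
    have h4 := h3.clm_apply (hasDerivAt_const (0 : ℝ) v)
    rw [zero_smul, add_zero, map_zero, add_zero] at h4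
    exact h4
  refine HasDerivAt.lhopital_zero_nhdsGT
    (f' := fun t => fderiv ℝ φ (z + t • v) v - fderiv ℝ φ z v) (g' := fun t => 2 * t) ?_ ?_ ?_ ?_ ?_ ?_
  · refine Eventually.of_forall fun t => ?_
    have h2 := (hasDerivAt_id t).mul_const (fderiv ℝ φ z v)
    rw [one_mul] at h2
    exact ((hasDerivAt_comp_add_smul (hφ.of_le one_le_two)).sub_const _).sub h2
  · refine Eventually.of_forall fun t => ?_
    simpa using hasDerivAt_pow 2 t
  · filter_upwards [self_mem_nhdsWithin] with t ht
    have : 0 < t := ht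
    positivity
  · have : Continuous fun t : ℝ => φ (z + t • v) - φ z - t * fderiv ℝ φ z v := by fun_prop
    simpa using (this.tendsto 0).mono_left nhdsWithin_le_nhds
  · have : Continuous fun t : ℝ => t ^ 2 := by fun_prop
    simpa using (this.tendsto 0).mono_left nhdsWithin_le_nhds
  · have h4 := (hasDerivAt_iff_tendsto_slope.1 hd2).mono_left
      (nhdsWithin_mono _ (fun t (ht : 0 < t) => ht.ne') : 𝓝[>] (0 : ℝ) ≤ 𝓝[≠] 0)
    refine (h4.div_const 2).congr fun t => ?_
    simp only [slope_def_field, zero_smul, add_zero, sub_zero]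
    rw [div_div, mul_comm]

lemma integral_fderiv_fderiv_eq_zero [FiniteDimensional ℝ E] [MeasurableSpace E] [BorelSpace E]
    {μ : Measure E} [μ.IsAddHaarMeasure] (hφ : ContDiff ℝ 2 φ) (hc : HasCompactSupport φ) (v : E) :
    ∫ z, fderiv ℝ (fderiv ℝ φ) z v v ∂μ = 0 := by
  set g : E → ℝ := fun z => fderiv ℝ φ z v with hg
  have hfd : ContDiff ℝ 1 (fderiv ℝ φ) := hφ.fderiv_right (by norm_num)
  have hg1 : ContDiff ℝ 1 g := hfd.clm_apply contDiff_const
  have hgc : HasCompactSupport g := hc.fderiv_apply ℝ v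
  have hgd : ∀ z, fderiv ℝ g z v = fderiv ℝ (fderiv ℝ φ) z v v := by
    intro z
    have : HasFDerivAt (fderiv ℝ φ) _ z := (hfd.differentiable one_ne_zero z).hasFDerivAt
    have := (this.clm_apply (hasFDerivAt_const v z)).fderiv
    rw [hg, this]
    simp
  have h := integral_smul_fderiv_eq_neg_fderiv_smul_of_integrable (μ := μ) (𝕜 := ℝ)
    (f := fun _ : E => (1 : ℝ)) (g := g) (v := v)
    (by simp) (by
      simp only [one_smul]
      exact (((hg1.continuous_fderiv one_ne_zero).clm_apply continuous_const).integrable_of_hasCompactSupport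
        (hgc.fderiv_apply ℝ v))) (by
      simp only [one_smul]
      exact hg1.continuous.integrable_of_hasCompactSupport hgc) (by fun_prop)
    (fun z _ => hg1.differentiable one_ne_zero z)
  simpa [hgd] using h

end SecondOrder

section CircleMean

lemma norm_exp_mul_I_smul {E : Type*} [NormedAddCommGroup E] [NormedSpace ℂ E] (θ : ℝ) (b : E) :
    ‖Complex.exp (θ * Complex.I) • b‖ = ‖b‖ := by
  rw [norm_smul, Complex.norm_exp_ofReal_mul_I, one_mul]

variable {E : Type*} [NormedAddCommGroup E] [NormedSpace ℝ E] [NormedSpace ℂ E] [IsScalarTower ℝ ℂ E]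
  {φ : E → ℝ}

/-- The mean of `φ` over the circle `{z + t e^{iθ} b}` in the complex line through `z` along `b`. -/
noncomputable def circleMean (φ : E → ℝ) (b : E) (t : ℝ) (z : E) : ℝ :=
  ⨍ θ in Ioc (0 : ℝ) (2 * Real.pi), φ (z + t • Complex.exp (θ * Complex.I) • b) ∂volume

/-- The Laplacian of `φ` along the complex line spanned by `b`, that is, four times the value of the
complex Hessian at `(b, b)`. -/
noncomputable def lineLaplacian (φ : E → ℝ) (b z : E) : ℝ :=
  fderiv ℝ (fderiv ℝ φ) z b b + fderiv ℝ (fderiv ℝ φ) z (Complex.I • b) (Complex.I • b)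

lemma setAverage_Ioc_two_pi (f : ℝ → ℝ) :
    ⨍ θ in Ioc (0 : ℝ) (2 * Real.pi), f θ ∂volume =
      (2 * Real.pi)⁻¹ * ∫ θ in (0 : ℝ)..(2 * Real.pi), f θ := by
  have := Real.pi_pos
  rw [setAverage_eq, intervalIntegral.integral_of_le (by positivity)]
  simp [Measure.real, this.le]

lemma exp_mul_I_smul (θ : ℝ) (b : E) :
    Complex.exp (θ * Complex.I) • b = Real.cos θ • b + Real.sin θ • (Complex.I • b) := by
  rw [Complex.exp_mul_I, add_smul, ← Complex.ofReal_cos, ← Complex.ofReal_sin, mul_smul]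
  exact congrArg₂ _ (algebraMap_smul ℂ (Real.cos θ) b) (algebraMap_smul ℂ (Real.sin θ) _)

/-- Linear terms have mean zero over circles, so the deviation of the circle mean from the central value
is the mean of the first-order Taylor remainder. -/
lemma circleMean_sub_eq (hφ : ContDiff ℝ 2 φ) (b : E) (t : ℝ) (z : E) :
    circleMean φ b t z - φ z = (2 * Real.pi)⁻¹ * ∫ θ in (0 : ℝ)..(2 * Real.pi),
      (φ (z + t • Complex.exp (θ * Complex.I) • b) - φ z -
        t * fderiv ℝ φ z (Complex.exp (θ * Complex.I) • b)) := by
  have hpi := Real.pi_pos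
  have hcont := hφ.continuous
  have hlin : ∫ θ in (0 : ℝ)..(2 * Real.pi), t * fderiv ℝ φ z (Complex.exp (θ * Complex.I) • b) = 0 := by
    simp_rw [exp_mul_I_smul, map_add, map_smul, smul_eq_mul]
    rw [intervalIntegral.integral_const_mul, intervalIntegral.integral_add
      (by apply Continuous.intervalIntegrable; fun_prop)
      (by apply Continuous.intervalIntegrable; fun_prop),
      intervalIntegral.integral_mul_const, intervalIntegral.integral_mul_const]
    simp
  have h1 : Continuous fun θ : ℝ => Complex.exp (θ * Complex.I) • b := by fun_prop
  rw [intervalIntegral.integral_sub (by apply Continuous.intervalIntegrable; fun_prop)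
      (by apply Continuous.intervalIntegrable; fun_prop), hlin,
    intervalIntegral.integral_sub (by apply Continuous.intervalIntegrable; fun_prop)
      (by apply Continuous.intervalIntegrable; fun_prop), circleMean, setAverage_Ioc_two_pi,
      intervalIntegral.integral_const]
  simp only [smul_eq_mul, sub_zero]
  rw [mul_sub, inv_mul_cancel_left₀ (by positivity)]

lemma exists_abs_circleMean_sub_le (hφ : ContDiff ℝ 2 φ) (hc : HasCompactSupport φ) (b : E) :
    ∃ M : ℝ, 0 ≤ M ∧ ∀ (t : ℝ) (z : E), |circleMean φ b t z - φ z| ≤ M * t ^ 2 := by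
  have hpi := Real.pi_pos
  obtain ⟨M, hM0, hM⟩ := exists_abs_sub_sub_fderiv_le hφ hc
  refine ⟨M * ‖b‖ ^ 2, by positivity, fun t z => ?_⟩
  rw [circleMean_sub_eq hφ, abs_mul, abs_of_nonneg (by positivity : 0 ≤ (2 * Real.pi)⁻¹),
    ← Real.norm_eq_abs]
  have := intervalIntegral.norm_integral_le_of_norm_le_const (a := 0) (b := 2 * Real.pi)
    (C := M * ‖b‖ ^ 2 * t ^ 2)
    (f := fun θ : ℝ => φ (z + t • Complex.exp (θ * Complex.I) • b) - φ z -
        t * fderiv ℝ φ z (Complex.exp (θ * Complex.I) • b)) (fun θ _ => by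
      have h := hM z (t • Complex.exp (θ * Complex.I) • b)
      rw [map_smul, norm_smul, norm_exp_mul_I_smul, mul_pow, Real.norm_eq_abs, sq_abs] at h
      rw [Real.norm_eq_abs]
      calc _ ≤ _ := h
        _ = _ := by ring)
  rw [sub_zero, abs_of_pos (by positivity)] at this
  calc _ ≤ (2 * Real.pi)⁻¹ * (M * ‖b‖ ^ 2 * t ^ 2 * (2 * Real.pi)) := by gcongr
    _ = _ := by field_simp

lemma tendsto_circleMean_sub_div (hφ : ContDiff ℝ 2 φ) (hc : HasCompactSupport φ) (b z : E) :
    Tendsto (fun t : ℝ => (circleMean φ b t z - φ z) / t ^ 2) (𝓝[>] 0)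
      (𝓝 (lineLaplacian φ b z / 4)) := by
  have hpi := Real.pi_pos
  have hcont := hφ.continuous
  have h1 : Continuous fun θ : ℝ => Complex.exp (θ * Complex.I) • b := by fun_prop
  obtain ⟨M, hM0, hM⟩ := exists_abs_sub_sub_fderiv_le hφ hc
  set D := fderiv ℝ (fderiv ℝ φ) z with hD
  have hint : ∫ θ in (0 : ℝ)..(2 * Real.pi),
      D (Complex.exp (θ * Complex.I) • b) (Complex.exp (θ * Complex.I) • b) / 2 =
      Real.pi / 2 * lineLaplacian φ b z := by
    have h2 : ∀ θ : ℝ, D (Complex.exp (θ * Complex.I) • b) (Complex.exp (θ * Complex.I) • b) / 2 =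
        Real.cos θ ^ 2 * (D b b / 2) + Real.sin θ ^ 2 * (D (Complex.I • b) (Complex.I • b) / 2)
        + Real.sin θ * Real.cos θ * ((D b (Complex.I • b) + D (Complex.I • b) b) / 2) := by
      intro θ
      rw [exp_mul_I_smul]
      simp only [map_add, map_smul, add_apply, smul_apply,
        smul_eq_mul]
      ring
    simp_rw [h2]
    rw [intervalIntegral.integral_add (by apply Continuous.intervalIntegrable; fun_prop)
      (by apply Continuous.intervalIntegrable; fun_prop),
      intervalIntegral.integral_add (by apply Continuous.intervalIntegrable; fun_prop)
      (by apply Continuous.intervalIntegrable; fun_prop),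
      intervalIntegral.integral_mul_const, intervalIntegral.integral_mul_const,
      intervalIntegral.integral_mul_const, integral_cos_sq, integral_sin_sq, integral_sin_mul_cos₁]
    simp only [Real.cos_two_pi, Real.sin_two_pi, Real.sin_zero, Real.cos_zero, lineLaplacian, ← hD]
    ring
  have hlim : Tendsto (fun t : ℝ => ∫ θ in (0 : ℝ)..(2 * Real.pi),
      (φ (z + t • Complex.exp (θ * Complex.I) • b) - φ z -
        t * fderiv ℝ φ z (Complex.exp (θ * Complex.I) • b)) / t ^ 2) (𝓝[>] 0)
      (𝓝 (∫ θ in (0 : ℝ)..(2 * Real.pi),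
        D (Complex.exp (θ * Complex.I) • b) (Complex.exp (θ * Complex.I) • b) / 2)) := by
    refine intervalIntegral.tendsto_integral_filter_of_dominated_convergence
      (fun _ => M * ‖b‖ ^ 2) ?_ ?_ (by simp) ?_
    · refine Eventually.of_forall fun t => Continuous.aestronglyMeasurable ?_
      fun_prop
    · filter_upwards [self_mem_nhdsWithin] with t (ht : 0 < t)
      refine Eventually.of_forall fun θ _ => ?_
      have h := hM z (t • Complex.exp (θ * Complex.I) • b)
      rw [map_smul, norm_smul, norm_exp_mul_I_smul, mul_pow, Real.norm_eq_abs, sq_abs] at h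
      rw [Real.norm_eq_abs, abs_div, abs_of_pos (by positivity : 0 < t ^ 2),
        div_le_iff₀ (by positivity)]
      calc _ ≤ _ := h
        _ = _ := by ring
    · exact Eventually.of_forall fun θ _ => tendsto_taylor_two hφ z _
  rw [hint] at hlim
  have h3 := hlim.const_mul (2 * Real.pi)⁻¹
  have h4 : (2 * Real.pi)⁻¹ * (Real.pi / 2 * lineLaplacian φ b z) = lineLaplacian φ b z / 4 := by
    field_simp; ring
  rw [h4] at h3
  refine h3.congr fun t => ?_
  rw [circleMean_sub_eq hφ, intervalIntegral.integral_div, mul_div_assoc]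

end CircleMean

/-- The Laplacian of `ℂⁿ = ℝ²ⁿ` is the sum of the Laplacians along the coordinate lines. -/
lemma laplacian_eq_sum_lineLaplacian {n : ℕ} (φ : EuclideanSpace ℂ (Fin n) → ℝ)
    (z : EuclideanSpace ℂ (Fin n)) :
    (Laplacian.laplacian φ : EuclideanSpace ℂ (Fin n) → ℝ) z =
      ∑ j, lineLaplacian φ (EuclideanSpace.single j (1 : ℂ)) z := by
  rw [InnerProductSpace.laplacian_eq_iteratedFDeriv_orthonormalBasis φ
    (Pi.orthonormalBasis fun _ : Fin n => Complex.orthonormalBasisOneI)]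
  have hI : ∀ j : Fin n, Complex.I • EuclideanSpace.single j (1 : ℂ) =
      EuclideanSpace.single j Complex.I := by
    intro j
    ext k
    simp [EuclideanSpace.single]
  simp only [iteratedFDeriv_two_apply, Fintype.sum_sigma, Fin.sum_univ_two, lineLaplacian, hI]
  simp [Pi.orthonormalBasis_apply, EuclideanSpace.single]

/-! ### Positivity of the distributional Laplacian -/

lemma continuous_circleMean {E : Type*} [NormedAddCommGroup E] [NormedSpace ℝ E] [NormedSpace ℂ E]
    {φ : E → ℝ} (hφ : Continuous φ) (b : E) (t : ℝ) :
    Continuous (circleMean φ b t) := by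
  unfold circleMean
  simp_rw [setAverage_Ioc_two_pi]
  refine continuous_const.mul ?_
  apply intervalIntegral.continuous_parametric_intervalIntegral_of_continuous'
  unfold Function.uncurry
  fun_prop

lemma continuous_lineLaplacian {E : Type*} [NormedAddCommGroup E] [NormedSpace ℝ E]
    [NormedSpace ℂ E] {φ : E → ℝ} (hφ : ContDiff ℝ 2 φ) (b : E) :
    Continuous (lineLaplacian φ b) := by
  have h := (hφ.fderiv_right (m := 1) (by norm_num)).continuous_fderiv one_ne_zero
  unfold lineLaplacian
  fun_prop

lemma lineLaplacian_eq_zero {E : Type*} [NormedAddCommGroup E] [NormedSpace ℝ E]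
    [NormedSpace ℂ E] {φ : E → ℝ} (b : E) {z : E} (hz : z ∉ tsupport φ) :
    lineLaplacian φ b z = 0 := by
  have h : fderiv ℝ (fderiv ℝ φ) z = 0 := by
    by_contra hne
    exact hz (tsupport_fderiv_subset ℝ (support_fderiv_subset ℝ hne))
  simp [lineLaplacian, h]

lemma ofReal_circleMean {E : Type*} [NormedAddCommGroup E] [NormedSpace ℝ E] [NormedSpace ℂ E]
    {φ : E → ℝ} (hφ : Continuous φ) (hφ0 : ∀ z, 0 ≤ φ z) (b : E) (t : ℝ) (z : E) :
    ENNReal.ofReal (circleMean φ b t z) = ⨍⁻ θ in Ioc (0 : ℝ) (2 * Real.pi),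
      ENNReal.ofReal (φ (z + t • Complex.exp (θ * Complex.I) • b)) ∂volume := by
  unfold circleMean average laverage
  refine ofReal_integral_eq_lintegral_ofReal ?_ (Eventually.of_forall fun θ => hφ0 _)
  refine Integrable.to_average ?_
  exact (Continuous.integrableOn_Icc (by fun_prop)).mono_set Ioc_subset_Icc_self

/-- If `W` has the super-mean value property over the circles of radius `t` along `b` centred at
points of the support of `φ ≥ 0`, then replacing `φ` by its circle means decreases `∫ W φ`: by
Tonelli and translation invariance the means can be moved from `φ` to `W`. -/
lemma lintegral_mul_circleMean_le {E : Type*} [NormedAddCommGroup E] [NormedSpace ℝ E]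
    [NormedSpace ℂ E] [FiniteDimensional ℝ E] [MeasurableSpace E] [BorelSpace E]
    {μ : Measure E} [μ.IsAddHaarMeasure] {W : E → ℝ≥0∞} (hW : Measurable W) {φ : E → ℝ}
    (hφ : Continuous φ) (hφ0 : ∀ z, 0 ≤ φ z) (b : E) (t : ℝ)
    (hmean : ∀ z, φ z ≠ 0 → ⨍⁻ θ in Ioc (0 : ℝ) (2 * Real.pi),
      W (z + Complex.exp (θ * Complex.I) • (-t • b)) ∂volume ≤ W z) :
    ∫⁻ z, W z * ENNReal.ofReal (circleMean φ b t z) ∂μ ≤ ∫⁻ z, W z * ENNReal.ofReal (φ z) ∂μ := by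
  have hcomm : ∀ (θ : ℝ), Complex.exp (θ * Complex.I) • (-t • b) =
      -(t • Complex.exp (θ * Complex.I) • b) := by
    intro θ
    rw [neg_smul, smul_neg, smul_comm]
  have htrans : ∀ θ : ℝ,
      ∫⁻ z, W z * ENNReal.ofReal (φ (z + t • Complex.exp (θ * Complex.I) • b)) ∂μ =
      ∫⁻ z, W (z + Complex.exp (θ * Complex.I) • (-t • b)) * ENNReal.ofReal (φ z) ∂μ := by
    intro θ
    rw [← lintegral_add_right_eq_self _ (Complex.exp (θ * Complex.I) • (-t • b))]
    refine lintegral_congr fun z => ?_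
    rw [hcomm, neg_add_cancel_right]
  calc ∫⁻ z, W z * ENNReal.ofReal (circleMean φ b t z) ∂μ
      = ∫⁻ z, ⨍⁻ θ in Ioc (0 : ℝ) (2 * Real.pi),
          W z * ENNReal.ofReal (φ (z + t • Complex.exp (θ * Complex.I) • b)) ∂volume ∂μ := by
        refine lintegral_congr fun z => ?_
        rw [ofReal_circleMean hφ hφ0]
        simp only [laverage]
        rw [lintegral_const_mul]
        exact (Continuous.measurable (by fun_prop)).ennreal_ofReal
    _ = ⨍⁻ θ in Ioc (0 : ℝ) (2 * Real.pi), ∫⁻ z,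
          W z * ENNReal.ofReal (φ (z + t • Complex.exp (θ * Complex.I) • b)) ∂μ ∂volume := by
        simp only [laverage]
        refine lintegral_lintegral_swap (Measurable.aemeasurable ?_)
        unfold Function.uncurry
        refine (hW.comp measurable_fst).mul (Continuous.measurable ?_).ennreal_ofReal
        fun_prop
    _ = ⨍⁻ θ in Ioc (0 : ℝ) (2 * Real.pi), ∫⁻ z,
          W (z + Complex.exp (θ * Complex.I) • (-t • b)) * ENNReal.ofReal (φ z) ∂μ ∂volume := by
        simp_rw [htrans]
    _ = ∫⁻ z, ⨍⁻ θ in Ioc (0 : ℝ) (2 * Real.pi),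
          W (z + Complex.exp (θ * Complex.I) • (-t • b)) * ENNReal.ofReal (φ z) ∂volume ∂μ := by
        simp only [laverage]
        refine lintegral_lintegral_swap (Measurable.aemeasurable ?_)
        unfold Function.uncurry
        refine (hW.comp (Continuous.measurable ?_)).mul
          (Continuous.measurable (by fun_prop)).ennreal_ofReal
        fun_prop
    _ ≤ ∫⁻ z, W z * ENNReal.ofReal (φ z) ∂μ := by
        refine lintegral_mono fun z => ?_
        rcases eq_or_ne (φ z) 0 with h | h
        · simp [h]
        · simp only [laverage]
          have h1 : Measurable fun θ : ℝ => W (z + Complex.exp (θ * Complex.I) • (-t • b)) :=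
            hW.comp (Continuous.measurable (by fun_prop))
          rw [lintegral_mul_const _ h1]
          exact mul_le_mul_left (hmean z h) _

section PositiveLaplacian

variable {n : ℕ} {Ω : Set (EuclideanSpace ℂ (Fin n))} {u : EuclideanSpace ℂ (Fin n) → EReal}

lemma lintegral_neg_lt_top_of_isCompact
    (hloc : ∀ z ∈ Ω, ∃ ρ > 0, ∫⁻ w in Metric.ball z ρ, (-u w).toENNReal < ⊤)
    {K : Set (EuclideanSpace ℂ (Fin n))} (hK : IsCompact K) (hKΩ : K ⊆ Ω) :
    ∫⁻ w in K, (-u w).toENNReal < ⊤ := by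
  rw [← withDensity_apply' _ K]
  refine hK.measure_lt_top_of_nhdsWithin fun z hz => ?_
  obtain ⟨ρ, hρ, h⟩ := hloc z (hKΩ hz)
  refine ⟨Metric.ball z ρ, mem_nhdsWithin_of_mem_nhds (Metric.ball_mem_nhds z hρ), ?_⟩
  rwa [withDensity_apply' _]

lemma ae_ne_bot_of_lintegral_neg_lt_top (hum : Measurable u)
    (hloc : ∀ z ∈ Ω, ∃ ρ > 0, ∫⁻ w in Metric.ball z ρ, (-u w).toENNReal < ⊤) :
    ∀ᵐ z ∂volume, z ∈ Ω → u z ≠ ⊥ := by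
  rw [ae_iff]
  refine measure_null_of_locally_null _ fun z hz => ?_
  simp only [mem_ofPred_eq, Classical.not_imp, not_not] at hz
  obtain ⟨ρ, hρ, h⟩ := hloc z hz.1
  have h1 := ae_lt_top (μ := volume.restrict (Metric.ball z ρ)) hum.neg.ereal_toENNReal h.ne
  rw [ae_restrict_iff' measurableSet_ball, ae_iff] at h1
  refine ⟨_, inter_mem_nhdsWithin _ (Metric.ball_mem_nhds z hρ), measure_mono_null ?_ h1⟩
  rintro w ⟨hw, hwb⟩
  simp only [mem_ofPred_eq, Classical.not_imp, not_not] at hw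
  simpa [hw.2] using hwb

lemma IsPlurisubharmonicOn.integrableOn_of_isCompact (hu : IsPlurisubharmonicOn u Ω)
    (hum : Measurable u)
    (hloc : ∀ z ∈ Ω, ∃ ρ > 0, ∫⁻ w in Metric.ball z ρ, (-u w).toENNReal < ⊤)
    {K : Set (EuclideanSpace ℂ (Fin n))} (hK : IsCompact K) (hKΩ : K ⊆ Ω) :
    IntegrableOn (fun z => (u z).toReal) K := by
  obtain ⟨M, hM⟩ := hu.exists_le_of_isCompact hK hKΩ
  refine ⟨(hum.ereal_toReal).aestronglyMeasurable, ?_⟩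
  have h1 := lintegral_neg_lt_top_of_isCompact hloc hK hKΩ
  have h2 : ∫⁻ z in K, ‖(u z).toReal‖ₑ ≤ ∫⁻ z in K, ((-u z).toENNReal + M) := by
    refine setLIntegral_mono' hK.measurableSet fun z hz => ?_
    have hz := hM z hz
    generalize u z = x at hz
    induction x with
    | bot => simp
    | top => simp
    | coe x =>
      have hx : x ≤ M := by exact_mod_cast hz
      rw [← EReal.coe_neg, EReal.toENNReal_of_ne_top (EReal.coe_ne_top _), EReal.toReal_coe,
        EReal.toReal_coe, Real.enorm_eq_ofReal_abs, ← ENNReal.ofReal_coe_nnreal]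
      rcases le_total 0 x with h | h
      · rw [abs_of_nonneg h]
        exact (ENNReal.ofReal_le_ofReal hx).trans le_add_self
      · rw [abs_of_nonpos h]
        exact le_self_add
  refine h2.trans_lt ?_
  rw [lintegral_add_right _ measurable_const, setLIntegral_const]
  exact ENNReal.add_lt_top.2 ⟨h1, ENNReal.mul_lt_top ENNReal.coe_lt_top hK.measure_lt_top⟩

/-- The distributional Laplacian of a plurisubharmonic function along a complex line is positive.
With `M` an upper bound of `u` near the support of `φ`, the function `M - u` integrates the
circle means of `φ` to at most what it integrates `φ` to; divide the difference by the square of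
the radius and let the radius tend to zero. -/
lemma IsPlurisubharmonicOn.integral_mul_lineLaplacian_nonneg (hu : IsPlurisubharmonicOn u Ω)
    (hum : Measurable u) (hΩ : IsOpen Ω)
    (hloc : ∀ z ∈ Ω, ∃ ρ > 0, ∫⁻ w in Metric.ball z ρ, (-u w).toENNReal < ⊤)
    {φ : EuclideanSpace ℂ (Fin n) → ℝ} (hφ : ContDiff ℝ 2 φ) (hc : HasCompactSupport φ)
    (hφΩ : tsupport φ ⊆ Ω) (hφ0 : ∀ z, 0 ≤ φ z) (b : EuclideanSpace ℂ (Fin n)) :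
    0 ≤ ∫ z in Ω, (u z).toReal * lineLaplacian φ b z := by
  obtain ⟨δ, hδ, hδΩ⟩ := hc.isCompact.exists_cthickening_subset_open hΩ hφΩ
  set K := Metric.cthickening δ (tsupport φ) with hK
  have hKc : IsCompact K := hc.isCompact.cthickening
  have hφK : tsupport φ ⊆ K := Metric.self_subset_cthickening _
  obtain ⟨M, hM⟩ := hu.exists_le_of_isCompact hKc hδΩ
  have hint := hu.integrableOn_of_isCompact hum hloc hKc hδΩ
  set w : EuclideanSpace ℂ (Fin n) → ℝ := fun z => M - (u z).toReal with hw
  have hwint : IntegrableOn w K := (integrableOn_const hKc.measure_lt_top.ne).sub hint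
  have hwae : ∀ᵐ z ∂volume.restrict K,
      (((M : ℝ) : EReal) - u z).toENNReal = ENNReal.ofReal (w z) ∧ 0 ≤ w z := by
    rw [ae_restrict_iff' hKc.measurableSet]
    filter_upwards [ae_ne_bot_of_lintegral_neg_lt_top hum hloc] with z hz hzK
    have h1 := hz (hδΩ hzK)
    have h2 := hM z hzK
    simp only [hw]
    generalize u z = x at h1 h2
    induction x with
    | bot => exact absurd rfl h1
    | top => simp at h2
    | coe x =>
      have hx : x ≤ M := by exact_mod_cast h2
      rw [← EReal.coe_sub, EReal.toENNReal_of_ne_top (EReal.coe_ne_top _),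
        EReal.toReal_coe, EReal.toReal_coe]
      exact ⟨rfl, sub_nonneg.2 hx⟩
  set W : EuclideanSpace ℂ (Fin n) → ℝ≥0∞ :=
    K.indicator fun z => (((M : ℝ) : EReal) - u z).toENNReal with hW
  have hWm : Measurable W :=
    (measurable_const.sub hum).ereal_toENNReal.indicator hKc.measurableSet
  have hWint : ∀ f : EuclideanSpace ℂ (Fin n) → ℝ, Continuous f → (∀ z, 0 ≤ f z) →
      ∫⁻ z, W z * ENNReal.ofReal (f z) = ENNReal.ofReal (∫ z in K, w z * f z) := by
    intro f hf hf0
    rw [ofReal_integral_eq_lintegral_ofReal (hwint.mul_continuousOn hf.continuousOn hKc)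
      (by filter_upwards [hwae] with z hz using mul_nonneg hz.2 (hf0 z))]
    have h1 : (fun z => W z * ENNReal.ofReal (f z)) = K.indicator fun z =>
        (((M : ℝ) : EReal) - u z).toENNReal * ENNReal.ofReal (f z) := by
      funext z
      by_cases hz : z ∈ K <;> simp [hW, hz]
    rw [h1, lintegral_indicator hKc.measurableSet]
    refine lintegral_congr_ae ?_
    filter_upwards [hwae] with z hz
    rw [hz.1, ENNReal.ofReal_mul hz.2]
  have hcont := hφ.continuous
  -- The mean value inequality, for circles that stay within the neighbourhood `K`.
  have hle : ∀ t : ℝ, 0 < t → t * ‖b‖ ≤ δ →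
      ∫ z in K, w z * circleMean φ b t z ≤ ∫ z in K, w z * φ z := by
    intro t ht htb
    have hcm0 : ∀ z, 0 ≤ circleMean φ b t z := fun z => by
      rw [circleMean, setAverage_Ioc_two_pi]
      have := Real.pi_pos
      exact mul_nonneg (by positivity)
        (intervalIntegral.integral_nonneg (by positivity) fun θ _ => hφ0 _)
    have h := lintegral_mul_circleMean_le (μ := volume) hWm hcont hφ0 b t (fun z hz => by
      have hzs : z ∈ tsupport φ := subset_tsupport φ hz
      have hdisc : ∀ ζ : ℂ, ‖ζ‖ ≤ 1 → z + ζ • (-t • b) ∈ K := by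
        intro ζ hζ
        refine Metric.mem_cthickening_of_dist_le _ z _ _ hzs ?_
        rw [dist_self_add_left, norm_smul, norm_smul, norm_neg, Real.norm_of_nonneg ht.le]
        exact (mul_le_of_le_one_left (by positivity) hζ).trans htb
      have h1 := hu.laverage_le hum (fun ζ hζ => hδΩ (hdisc ζ hζ)) (fun ζ hζ => hM _ (hdisc ζ hζ))
      have h2 : ∀ θ : ℝ, z + Complex.exp (θ * Complex.I) • (-t • b) ∈ K :=
        fun θ => hdisc _ (Complex.norm_exp_ofReal_mul_I θ).le
      simp only [hW, indicator_of_mem (hφK hzs), indicator_of_mem (h2 _)]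
      exact h1)
    rw [hWint _ (continuous_circleMean hcont b t) hcm0, hWint _ hcont hφ0] at h
    refine (ENNReal.ofReal_le_ofReal_iff ?_).1 h
    exact integral_nonneg_of_ae
      (by filter_upwards [hwae] with z hz using mul_nonneg hz.2 (hφ0 z))
  obtain ⟨B, hB0, hB⟩ := exists_abs_circleMean_sub_le hφ hc b
  have hlim : Tendsto (fun t : ℝ => ∫ z in K, w z * ((circleMean φ b t z - φ z) / t ^ 2)) (𝓝[>] 0)
      (𝓝 (∫ z in K, w z * (lineLaplacian φ b z / 4))) := by
    refine tendsto_integral_filter_of_dominated_convergence (fun z => ‖w z‖ * B) ?_ ?_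
      (hwint.norm.mul_const B) ?_
    · refine Eventually.of_forall fun t => hwint.aestronglyMeasurable.mul
        (Continuous.aestronglyMeasurable ?_)
      exact ((continuous_circleMean hcont b t).sub hcont).div_const _
    · filter_upwards [self_mem_nhdsWithin] with t (ht : 0 < t)
      refine Eventually.of_forall fun z => ?_
      rw [norm_mul]
      refine mul_le_mul_of_nonneg_left ?_ (norm_nonneg _)
      rw [Real.norm_eq_abs, abs_div, abs_of_pos (by positivity : 0 < t ^ 2),
        div_le_iff₀ (by positivity)]
      exact hB t z
    · exact Eventually.of_forall fun z => (tendsto_circleMean_sub_div hφ hc b z).const_mul _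
  have hle0 : ∫ z in K, w z * (lineLaplacian φ b z / 4) ≤ 0 := by
    refine le_of_tendsto hlim ?_
    have hsmall : ∀ᶠ t : ℝ in 𝓝[>] 0, t * ‖b‖ ≤ δ := by
      have : Tendsto (fun t : ℝ => t * ‖b‖) (𝓝[>] 0) (𝓝 0) := by
        have h : Continuous fun t : ℝ => t * ‖b‖ := by fun_prop
        simpa using (h.tendsto 0).mono_left nhdsWithin_le_nhds
      exact this.eventually (eventually_le_nhds hδ)
    filter_upwards [self_mem_nhdsWithin, hsmall] with t (ht : 0 < t) htb
    have h1 : ∫ z in K, w z * ((circleMean φ b t z - φ z) / t ^ 2) =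
        ((∫ z in K, w z * circleMean φ b t z) - ∫ z in K, w z * φ z) / t ^ 2 := by
      rw [← integral_sub
        (hwint.mul_continuousOn (continuous_circleMean hcont b t).continuousOn hKc)
        (hwint.mul_continuousOn hcont.continuousOn hKc), ← integral_div]
      refine integral_congr_ae (Eventually.of_forall fun z => ?_)
      simp only
      ring
    rw [h1]
    exact div_nonpos_of_nonpos_of_nonneg (sub_nonpos.2 (hle t ht htb)) (by positivity)
  have hll := continuous_lineLaplacian hφ b
  have hzero : ∀ z, z ∉ K → lineLaplacian φ b z = 0 :=
    fun z hz => lineLaplacian_eq_zero b fun h => hz (hφK h)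
  have hmean0 : ∫ z in K, lineLaplacian φ b z = 0 := by
    rw [setIntegral_eq_integral_of_forall_compl_eq_zero hzero]
    have hfd : Continuous (fderiv ℝ (fderiv ℝ φ)) :=
      (hφ.fderiv_right (m := 1) (by norm_num)).continuous_fderiv one_ne_zero
    have hcs : ∀ v, HasCompactSupport fun z => fderiv ℝ (fderiv ℝ φ) z v v := by
      intro v
      refine HasCompactSupport.comp_left
        (g := fun L : EuclideanSpace ℂ (Fin n) →L[ℝ] EuclideanSpace ℂ (Fin n) →L[ℝ] ℝ => L v v)
        ((hc.fderiv (𝕜 := ℝ)).fderiv (𝕜 := ℝ)) (by simp)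
    unfold lineLaplacian
    rw [integral_add
      (Continuous.integrable_of_hasCompactSupport (by fun_prop) (hcs _))
      (Continuous.integrable_of_hasCompactSupport (by fun_prop) (hcs _)),
      integral_fderiv_fderiv_eq_zero hφ hc, integral_fderiv_fderiv_eq_zero hφ hc, add_zero]
  have hset : ∫ z in Ω, (u z).toReal * lineLaplacian φ b z =
      ∫ z in K, (u z).toReal * lineLaplacian φ b z := by
    refine setIntegral_eq_of_subset_of_forall_sdiff_eq_zero hΩ.measurableSet hδΩ fun z hz => ?_
    rw [hzero z hz.2, mul_zero]
  rw [hset]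
  have hexp : ∫ z in K, w z * (lineLaplacian φ b z / 4) =
      -(∫ z in K, (u z).toReal * lineLaplacian φ b z) / 4 := by
    have h1 : ∀ z, w z * (lineLaplacian φ b z / 4) =
        (M * lineLaplacian φ b z - (u z).toReal * lineLaplacian φ b z) / 4 := by
      intro z; simp only [hw]; ring
    simp_rw [h1]
    rw [integral_div, integral_sub ((hll.continuousOn.integrableOn_compact hKc).const_mul _)
      (hint.mul_continuousOn hll.continuousOn hKc), integral_const_mul, hmean0]
    simp
  rw [hexp] at hle0
  linarith

lemma IsPlurisubharmonicOn.integral_mul_laplacian_nonneg (hu : IsPlurisubharmonicOn u Ω)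
    (hum : Measurable u) (hΩ : IsOpen Ω)
    (hloc : ∀ z ∈ Ω, ∃ ρ > 0, ∫⁻ w in Metric.ball z ρ, (-u w).toENNReal < ⊤)
    {φ : EuclideanSpace ℂ (Fin n) → ℝ} (hφ : ContDiff ℝ 2 φ) (hc : HasCompactSupport φ)
    (hφΩ : tsupport φ ⊆ Ω) (hφ0 : ∀ z, 0 ≤ φ z) :
    0 ≤ ∫ z in Ω, (u z).toReal * (Laplacian.laplacian φ : EuclideanSpace ℂ (Fin n) → ℝ) z := by
  simp_rw [laplacian_eq_sum_lineLaplacian, Finset.mul_sum]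
  rw [integral_finsetSum]
  · exact Finset.sum_nonneg fun j _ =>
      hu.integral_mul_lineLaplacian_nonneg hum hΩ hloc hφ hc hφΩ hφ0 _
  · intro j _
    have h1 := (hu.integrableOn_of_isCompact hum hloc hc.isCompact hφΩ).mul_continuousOn
      (continuous_lineLaplacian hφ (EuclideanSpace.single j (1 : ℂ))).continuousOn hc.isCompact
    refine (h1.integrable_of_forall_notMem_eq_zero fun z hz => ?_).integrableOn
    rw [lineLaplacian_eq_zero _ hz, mul_zero]

end PositiveLaplacian

/-! ### Positive distributions and the Riesz measure -/

section PositiveDistribution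

variable {E : Type*} [NormedAddCommGroup E] [NormedSpace ℝ E]

/-- `φ` is a real test function on the open set `Ω`, that is, `φ ∈ C_c^∞(Ω)`. -/
structure IsTestFunctionOn (φ : E → ℝ) (Ω : Set E) : Prop where
  contDiff : ContDiff ℝ ∞ φ
  hasCompactSupport : HasCompactSupport φ
  tsupport_subset : tsupport φ ⊆ Ω

lemma IsTestFunctionOn.contDiff_two {φ : E → ℝ} {Ω : Set E} (h : IsTestFunctionOn φ Ω) :
    ContDiff ℝ 2 φ :=
  contDiff_infty.1 h.contDiff 2

lemma exists_isTestFunctionOn_eq_one [FiniteDimensional ℝ E] {Ω K : Set E} (hΩ : IsOpen Ω)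
    (hK : IsCompact K) (hKΩ : K ⊆ Ω) :
    ∃ χ : E → ℝ, IsTestFunctionOn χ Ω ∧ (∀ z, 0 ≤ χ z) ∧ ∀ z ∈ K, χ z = 1 := by
  obtain ⟨δ, hδ, hδΩ⟩ := hK.exists_cthickening_subset_open hΩ hKΩ
  obtain ⟨f, hf1, hf0, hf⟩ := exists_contMDiffMap_one_nhds_of_subset_interior (n := ⊤)
    (modelWithCornersSelf ℝ E) hK.isClosed ((Metric.self_subset_thickening hδ K).trans
      (Metric.thickening_subset_interior_cthickening δ K))
  have hts : tsupport (f : E → ℝ) ⊆ Metric.cthickening δ K := by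
    refine closure_minimal (fun z hz => ?_) Metric.isClosed_cthickening
    by_contra h
    exact hz (hf0 z h)
  exact ⟨f, ⟨f.contMDiff.contDiff, hK.cthickening.of_isClosed_subset (isClosed_tsupport _) hts,
    hts.trans hδΩ⟩, fun z => (hf z).1, fun z hz => hf1.self_of_nhdsSet z hz⟩

/-- A positive distribution is a Radon measure. The M. Riesz extension theorem extends the functional
from `C_c^∞(Ω)` to a positive functional on `C_c(Ω)`, to which the Riesz–Markov–Kakutani theorem
applies; no density of the smooth functions is needed. -/
theorem exists_measure_of_positive_distribution [FiniteDimensional ℝ E] [MeasurableSpace E]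
    [BorelSpace E] {Ω : Set E} (hΩ : IsOpen Ω) (L : (E → ℝ) → ℝ)
    (hadd : ∀ φ ψ, IsTestFunctionOn φ Ω → IsTestFunctionOn ψ Ω → L (φ + ψ) = L φ + L ψ)
    (hsmul : ∀ (c : ℝ) φ, IsTestFunctionOn φ Ω → L (c • φ) = c * L φ)
    (hnonneg : ∀ φ, IsTestFunctionOn φ Ω → (∀ z, 0 ≤ φ z) → 0 ≤ L φ) :
    ∃ μ : Measure E, μ Ωᶜ = 0 ∧ (∀ K ⊆ Ω, IsCompact K → μ K < ⊤) ∧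
      ∀ φ, IsTestFunctionOn φ Ω → ∫ z, φ z ∂μ = L φ := by
  have : LocallyCompactSpace Ω := hΩ.locallyCompactSpace
  set ext : (Ω → ℝ) →ₗ[ℝ] (E → ℝ) := Function.ExtendByZero.linearMap ℝ (Subtype.val : Ω → E) with hext
  have hext_apply : ∀ f : Ω → ℝ, ext f = Function.extend Subtype.val f 0 := fun f => rfl
  have htest : ∀ f : CompactlySupportedContinuousMap Ω ℝ, ContDiff ℝ ∞ (ext f) →
      IsTestFunctionOn (ext f) Ω := by
    intro f hf
    refine ⟨hf, ?_, ?_⟩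
    · rw [hext_apply]
      exact f.hasCompactSupport.extend_zero continuous_subtype_val
    · rw [hext_apply]
      refine (f.hasCompactSupport.tsupport_extend_zero_subset continuous_subtype_val).trans ?_
      rintro _ ⟨z, -, rfl⟩
      exact z.2
  let p : Submodule ℝ (CompactlySupportedContinuousMap Ω ℝ) :=
    { carrier := {f | ContDiff ℝ ∞ (ext f)}
      add_mem' := fun {f g} hf hg => by
        simp only [mem_ofPred_eq, CompactlySupportedContinuousMap.coe_add, map_add] at *
        exact hf.add hg
      zero_mem' := by
        simp only [mem_ofPred_eq, CompactlySupportedContinuousMap.coe_zero, map_zero]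
        exact contDiff_const
      smul_mem' := fun c f hf => by
        simp only [mem_ofPred_eq, CompactlySupportedContinuousMap.coe_smul, map_smul] at *
        exact hf.const_smul c }
  have hp : ∀ f : p, IsTestFunctionOn (ext (f : CompactlySupportedContinuousMap Ω ℝ)) Ω :=
    fun f => htest _ f.2
  let F : CompactlySupportedContinuousMap Ω ℝ →ₗ.[ℝ] ℝ :=
    { domain := p
      toFun :=
        { toFun := fun f => L (ext (f : CompactlySupportedContinuousMap Ω ℝ))
          map_add' := fun f g => by
            simp only [Submodule.coe_add, CompactlySupportedContinuousMap.coe_add, map_add]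
            exact hadd _ _ (hp f) (hp g)
          map_smul' := fun c f => by
            simp only [Submodule.coe_smul, CompactlySupportedContinuousMap.coe_smul, map_smul]
            exact hsmul c _ (hp f) } }
  let s : PointedCone ℝ (CompactlySupportedContinuousMap Ω ℝ) :=
    { carrier := {f | ∀ z, 0 ≤ f z}
      add_mem' := fun {f g} hf hg z => add_nonneg (hf z) (hg z)
      zero_mem' := fun z => le_rfl
      smul_mem' := fun c f hf z => mul_nonneg c.2 (hf z) }
  have hrestrict : ∀ φ, IsTestFunctionOn φ Ω →
      ∃ f : p, ((f : CompactlySupportedContinuousMap Ω ℝ) : Ω → ℝ) = fun z : Ω => φ z := by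
    intro φ hφ
    have hcomp : HasCompactSupport fun z : Ω => φ z := by
      refine HasCompactSupport.intro (K := Subtype.val ⁻¹' tsupport φ) ?_ fun z hz =>
        image_eq_zero_of_notMem_tsupport hz
      rw [Subtype.isCompact_iff, Subtype.image_preimage_coe,
        inter_eq_right.2 hφ.tsupport_subset]
      exact hφ.hasCompactSupport
    refine ⟨⟨⟨⟨fun z : Ω => φ z, hφ.contDiff.continuous.comp continuous_subtype_val⟩, hcomp⟩, ?_⟩,
      rfl⟩
    change ContDiff ℝ ∞ (ext fun z : Ω => φ z)
    convert hφ.contDiff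
    funext z
    rw [hext_apply]
    by_cases hz : z ∈ Ω
    · exact Subtype.val_injective.extend_apply (fun z : Ω => φ z) 0 ⟨z, hz⟩
    · rw [Function.extend_apply' _ _ _ (by rintro ⟨a, rfl⟩; exact hz a.2)]
      exact (image_eq_zero_of_notMem_tsupport fun h => hz (hφ.tsupport_subset h)).symm
  obtain ⟨g, hgF, hgs⟩ := riesz_extension s F
    (fun f hf => hnonneg _ (hp f) fun z => by
      rw [hext_apply]
      by_cases hz : ∃ a : Ω, a.1 = z
      · obtain ⟨a, rfl⟩ := hz
        rw [Subtype.val_injective.extend_apply]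
        exact hf a
      · rw [Function.extend_apply' _ _ _ hz]
        rfl)
    (fun f => by
      -- A multiple of a smooth cutoff function that is `1` on the support of `f` dominates `-f`.
      have hK : IsCompact (Subtype.val '' tsupport f : Set E) :=
        f.hasCompactSupport.isCompact.image continuous_subtype_val
      obtain ⟨χ, hχ, hχ0, hχ1⟩ := exists_isTestFunctionOn_eq_one hΩ hK
        (by rintro _ ⟨z, -, rfl⟩; exact z.2)
      obtain ⟨h, hh⟩ := hrestrict χ hχ
      obtain ⟨C, hC⟩ := f.hasCompactSupport.exists_bound_of_continuous f.continuous
      refine ⟨⟨C • (h : CompactlySupportedContinuousMap Ω ℝ), p.smul_mem C h.2⟩, fun z => ?_⟩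
      have hhz : (h : CompactlySupportedContinuousMap Ω ℝ) z = χ z := congrFun hh z
      change 0 ≤ C * (h : CompactlySupportedContinuousMap Ω ℝ) z + f z
      have hCz := abs_le.1 (hC z)
      rw [hhz]
      by_cases hz : z ∈ tsupport f
      · rw [hχ1 z ⟨z, hz, rfl⟩]
        linarith [hCz.1]
      · rw [image_eq_zero_of_notMem_tsupport hz, add_zero]
        exact mul_nonneg ((norm_nonneg _).trans (hC z)) (hχ0 z))
  let Λ : CompactlySupportedContinuousMap Ω ℝ →ₚ[ℝ] ℝ := PositiveLinearMap.mk₀ g fun f hf =>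
    hgs f fun z => hf z
  refine ⟨(RealRMK.rieszMeasure Λ).map Subtype.val, ?_, fun K hKΩ hK => ?_, fun φ hφ => ?_⟩
  · rw [Measure.map_apply measurable_subtype_coe hΩ.measurableSet.compl]
    simp
  · rw [Measure.map_apply measurable_subtype_coe hK.measurableSet]
    refine IsCompact.measure_lt_top ?_
    rw [Subtype.isCompact_iff, Subtype.image_preimage_coe, inter_eq_right.2 hKΩ]
    exact hK
  · rw [(MeasurableEmbedding.subtype_coe hΩ.measurableSet).integral_map]
    obtain ⟨f, hf⟩ := hrestrict φ hφ
    have h1 := RealRMK.integral_rieszMeasure Λ f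
    rw [hf] at h1
    rw [h1]
    change g f = L φ
    rw [hgF f]
    change L (ext (f : CompactlySupportedContinuousMap Ω ℝ)) = L φ
    congr 1
    rw [hf]
    funext z
    rw [hext_apply]
    by_cases hz : z ∈ Ω
    · exact Subtype.val_injective.extend_apply (fun z : Ω => φ z) 0 ⟨z, hz⟩
    · rw [Function.extend_apply' _ _ _ (by rintro ⟨a, rfl⟩; exact hz a.2)]
      exact (image_eq_zero_of_notMem_tsupport fun h => hz (hφ.tsupport_subset h)).symm

end PositiveDistribution

section RieszMeasure

variable {n : ℕ} {Ω : Set (EuclideanSpace ℂ (Fin n))} {u : EuclideanSpace ℂ (Fin n) → EReal}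

lemma integrableOn_mul_laplacian
    (hloc : ∀ K ⊆ Ω, IsCompact K → IntegrableOn (fun z => (u z).toReal) K)
    {φ : EuclideanSpace ℂ (Fin n) → ℝ} (hφ : IsTestFunctionOn φ Ω) :
    IntegrableOn (fun z => (u z).toReal *
      (Laplacian.laplacian φ : EuclideanSpace ℂ (Fin n) → ℝ) z) Ω := by
  have hcont : Continuous (Laplacian.laplacian φ : EuclideanSpace ℂ (Fin n) → ℝ) := by
    have : (Laplacian.laplacian φ : EuclideanSpace ℂ (Fin n) → ℝ) =
        fun z => ∑ j, lineLaplacian φ (EuclideanSpace.single j (1 : ℂ)) z :=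
      funext fun z => laplacian_eq_sum_lineLaplacian φ z
    rw [this]
    exact continuous_finsetSum _ fun j _ => continuous_lineLaplacian hφ.contDiff_two _
  have h1 := (hloc _ hφ.tsupport_subset hφ.hasCompactSupport).mul_continuousOn
    hcont.continuousOn hφ.hasCompactSupport.isCompact
  refine (h1.integrable_of_forall_notMem_eq_zero fun z hz => ?_).integrableOn
  rw [laplacian_eq_sum_lineLaplacian, Finset.sum_eq_zero fun j _ => lineLaplacian_eq_zero _ hz,
    mul_zero]

lemma IsRieszMeasure.congr {v : EuclideanSpace ℂ (Fin n) → EReal}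
    {μ : Measure (EuclideanSpace ℂ (Fin n))} (h : IsRieszMeasure Ω u μ) (hΩ : IsOpen Ω)
    (huv : EqOn u v Ω) : IsRieszMeasure Ω v μ where
  ae_finite := by
    filter_upwards [h.ae_finite] with z hz hzΩ
    rw [← huv hzΩ]
    exact hz hzΩ
  locallyIntegrableOn := by
    intro z hz
    obtain ⟨s, hs, hsi⟩ := h.locallyIntegrableOn z hz
    rw [hΩ.nhdsWithin_eq hz] at hs ⊢
    obtain ⟨t, hts, hto, hzt⟩ := mem_nhds_iff.1 (inter_mem hs (hΩ.mem_nhds hz))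
    refine ⟨t, hto.mem_nhds hzt, ?_⟩
    exact (hsi.mono_set fun w hw => (hts hw).1).congr_fun
      (fun w hw => congrArg EReal.toReal (huv (hts hw).2)) hto.measurableSet
  compl_eq_zero := h.compl_eq_zero
  lt_top_of_isCompact := h.lt_top_of_isCompact
  integral_eq φ h1 h2 h3 := by
    rw [h.integral_eq φ h1 h2 h3]
    exact setIntegral_congr_fun hΩ.measurableSet fun z hz => by simp only [huv hz]

/-- Every plurisubharmonic function on a domain that is not identically `-∞` has a Riesz measure. -/
theorem IsPlurisubharmonicOn.exists_isRieszMeasure (hu : IsPlurisubharmonicOn u Ω)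
    (hΩ : IsOpen Ω) (hconn : IsPreconnected Ω) (hne : ∃ z ∈ Ω, u z ≠ ⊥) :
    ∃ μ : Measure (EuclideanSpace ℂ (Fin n)), IsRieszMeasure Ω u μ := by
  classical
  -- Only the values on `Ω` matter, so `u` may be assumed Borel measurable.
  wlog hum : Measurable u generalizing u
  · have heq : EqOn u (fun z => if z ∈ Ω then u z else ⊤) Ω := fun z hz => by simp [hz]
    obtain ⟨z, hz, hzu⟩ := hne
    obtain ⟨μ, hμ⟩ := this (hu.congr heq) ⟨z, hz, by simpa [hz] using hzu⟩
      (hu.upperSemicontinuousOn.measurable_ite_top hΩ)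
    exact ⟨μ, hμ.congr hΩ heq.symm⟩
  have hloc := hu.exists_lintegral_neg_lt_top hum hΩ hconn hne
  have hint : ∀ K ⊆ Ω, IsCompact K → IntegrableOn (fun z => (u z).toReal) K :=
    fun K hKΩ hK => hu.integrableOn_of_isCompact hum hloc hK hKΩ
  obtain ⟨μ, h1, h2, h3⟩ := exists_measure_of_positive_distribution hΩ
    (fun φ => ∫ z in Ω, (u z).toReal * (Laplacian.laplacian φ : EuclideanSpace ℂ (Fin n) → ℝ) z)
    (fun φ ψ hφ hψ => by
      rw [← integral_add (integrableOn_mul_laplacian hint hφ) (integrableOn_mul_laplacian hint hψ)]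
      refine integral_congr_ae (Eventually.of_forall fun z => ?_)
      simp only
      rw [hφ.contDiff_two.contDiffAt.laplacian_add hψ.contDiff_two.contDiffAt, mul_add])
    (fun c φ hφ => by
      rw [← integral_const_mul]
      refine integral_congr_ae (Eventually.of_forall fun z => ?_)
      simp only
      rw [InnerProductSpace.laplacian_smul c hφ.contDiff_two.contDiffAt, smul_eq_mul]
      ring)
    (fun φ hφ hφ0 => hu.integral_mul_laplacian_nonneg hum hΩ hloc hφ.contDiff_two
      hφ.hasCompactSupport hφ.tsupport_subset hφ0)
  refine ⟨μ, ?_, ?_, h1, h2, fun φ hφ hc hφΩ => h3 φ ⟨hφ, hc, hφΩ⟩⟩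
  · filter_upwards [ae_ne_bot_of_lintegral_neg_lt_top hum hloc] with z hz hzΩ
    exact ⟨hz hzΩ, (hu.lt_top z hzΩ).ne⟩
  · exact (locallyIntegrableOn_iff hΩ.isLocallyClosed).2 hint

end RieszMeasure

/-! ### The weighted estimate -/

/-- A smooth function vanishing near `0` and equal to `s ^ (1 + ε)` for large `s`, whose derivatives
obey, up to a constant, the bounds that those of the power obey. -/
lemma exists_smooth_truncated_rpow {ε : ℝ} (hε : 0 < ε) :
    ∃ (G : ℝ → ℝ) (A : ℝ), ContDiff ℝ ∞ G ∧ (∀ s ≤ 1, G s = 0) ∧ (∀ s, 2 ≤ s → G s = s ^ (1 + ε)) ∧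
      (∀ s, 0 ≤ G s) ∧ 0 ≤ A ∧ ∀ s, 0 < s →
        |deriv G s| ≤ A * s ^ ε ∧ |deriv (deriv G) s| ≤ A * s ^ (-1 + ε) := by
  set G : ℝ → ℝ := fun s => s ^ (1 + ε) * Real.smoothTransition (s - 1) with hG
  have h0 : ∀ s ≤ 1, G s = 0 := fun s hs => by
    simp [hG, Real.smoothTransition.zero_of_nonpos (sub_nonpos.2 hs)]
  have h2 : ∀ s, 2 ≤ s → G s = s ^ (1 + ε) := fun s hs => by
    simp [hG, Real.smoothTransition.one_of_one_le (by linarith : 1 ≤ s - 1)]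
  have hsmooth : ContDiff ℝ ∞ G := by
    rw [contDiff_iff_contDiffAt]
    intro s
    rcases lt_or_ge s 1 with hs | hs
    · have : G =ᶠ[𝓝 s] fun _ => 0 := by
        filter_upwards [Iio_mem_nhds hs] with x hx using h0 x (le_of_lt hx)
      exact contDiffAt_const.congr_of_eventuallyEq this
    · refine (Real.contDiffAt_rpow_const_of_ne (by linarith)).mul ?_
      exact (Real.smoothTransition.contDiff.comp (contDiff_id.sub contDiff_const)).contDiffAt
  have hd1 : ContDiff ℝ ∞ (deriv G) := (contDiff_infty_iff_deriv.1 hsmooth).2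
  have hd2 : ContDiff ℝ ∞ (deriv (deriv G)) := (contDiff_infty_iff_deriv.1 hd1).2
  obtain ⟨A₁, hA₁⟩ := (isCompact_Icc (a := (1 : ℝ)) (b := 2)).exists_bound_of_continuousOn
    (f := fun s => deriv G s / s ^ ε)
    (hd1.continuous.continuousOn.div (fun s hs => (Real.continuousAt_rpow_const s ε
      (Or.inl (by linarith [hs.1]))).continuousWithinAt)
      (fun s hs => (Real.rpow_pos_of_pos (by linarith [hs.1]) _).ne'))
  obtain ⟨A₂, hA₂⟩ := (isCompact_Icc (a := (1 : ℝ)) (b := 2)).exists_bound_of_continuousOn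
    (f := fun s => deriv (deriv G) s / s ^ (-1 + ε))
    (hd2.continuous.continuousOn.div (fun s hs => (Real.continuousAt_rpow_const s (-1 + ε)
      (Or.inl (by linarith [hs.1]))).continuousWithinAt)
      (fun s hs => (Real.rpow_pos_of_pos (by linarith [hs.1]) _).ne'))
  have h1mem : (1 : ℝ) ∈ Icc (1 : ℝ) 2 := ⟨le_rfl, one_le_two⟩
  have hA₁0 : 0 ≤ A₁ := (norm_nonneg _).trans (hA₁ 1 h1mem)
  have hA₂0 : 0 ≤ A₂ := (norm_nonneg _).trans (hA₂ 1 h1mem)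
  refine ⟨G, A₁ + A₂ + (1 + ε) * (1 + ε), hsmooth, h0, h2, fun s => ?_, by positivity,
    fun s hs => ?_⟩
  · rcases le_or_gt s 1 with h | h
    · exact (h0 s h).ge
    · exact mul_nonneg (Real.rpow_nonneg (by linarith) _) (Real.smoothTransition.nonneg _)
  have hp1 : 0 < s ^ ε := Real.rpow_pos_of_pos hs _
  have hp2 : 0 < s ^ (-1 + ε) := Real.rpow_pos_of_pos hs _
  rcases lt_or_ge s 1 with h | h
  · have e0 : G =ᶠ[𝓝 s] fun _ => 0 := by
      filter_upwards [Iio_mem_nhds h] with x hx using h0 x (le_of_lt hx)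
    have e1 : deriv G =ᶠ[𝓝 s] fun _ => 0 := by simpa using e0.deriv
    have e2 : deriv (deriv G) s = 0 := by simpa using e1.deriv_eq
    rw [e1.self_of_nhds, e2, abs_zero]
    constructor <;> positivity
  rcases le_or_gt s 2 with h' | h'
  · have b1 := hA₁ s ⟨h, h'⟩
    have b2 := hA₂ s ⟨h, h'⟩
    rw [Real.norm_eq_abs, abs_div, abs_of_pos hp1, div_le_iff₀ hp1] at b1
    rw [Real.norm_eq_abs, abs_div, abs_of_pos hp2, div_le_iff₀ hp2] at b2
    refine ⟨b1.trans ?_, b2.trans ?_⟩ <;> gcongr <;> nlinarith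
  · have e0 : G =ᶠ[𝓝 s] fun x => x ^ (1 + ε) := by
      filter_upwards [Ioi_mem_nhds h'] with x hx using h2 x (le_of_lt hx)
    have e1 : deriv G =ᶠ[𝓝 s] fun x => (1 + ε) * x ^ ε := by
      refine e0.deriv.trans ?_
      filter_upwards [Ioi_mem_nhds hs] with x (hx : 0 < x)
      rw [Real.deriv_rpow_const]
      simp
    have e2 : deriv (deriv G) s = (1 + ε) * (ε * s ^ (-1 + ε)) := by
      rw [e1.deriv_eq, deriv_const_mul _ (Real.differentiableAt_rpow_const_of_ne _ hs.ne'),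
        Real.deriv_rpow_const, sub_eq_neg_add]
    rw [e1.self_of_nhds, e2, abs_of_nonneg (by positivity), abs_of_nonneg (by positivity),
      ← mul_assoc]
    exact ⟨mul_le_mul_of_nonneg_right (by nlinarith) hp1.le,
      mul_le_mul_of_nonneg_right (by nlinarith) hp2.le⟩

/-- By scaling, the power `t ^ (1 + ε)` can be cut off smoothly below any level `δ` with derivative
bounds that do not depend on `δ`. -/
lemma exists_smooth_cutoff_rpow {ε : ℝ} (hε : 0 < ε) :
    ∃ A : ℝ, 0 ≤ A ∧ ∀ δ : ℝ, 0 < δ → ∃ g : ℝ → ℝ, ContDiff ℝ ∞ g ∧ (∀ t ≤ δ, g t = 0) ∧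
      (∀ t, 2 * δ ≤ t → g t = t ^ (1 + ε)) ∧ (∀ t, 0 ≤ g t) ∧ ∀ t, 0 < t →
        |deriv g t| ≤ A * t ^ ε ∧ |deriv (deriv g) t| ≤ A * t ^ (-1 + ε) := by
  obtain ⟨G, A, hG, h0, h2, hnn, hA, hb⟩ := exists_smooth_truncated_rpow hε
  refine ⟨A, hA, fun δ hδ => ⟨fun t => δ ^ (1 + ε) * G (t / δ), ?_, fun t ht => ?_,
    fun t ht => ?_, fun t => ?_, fun t ht => ?_⟩⟩
  · exact contDiff_const.mul (hG.comp (contDiff_id.div_const δ))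
  · simp only [h0 _ ((div_le_one hδ).2 ht), mul_zero]
  · simp only [h2 _ ((le_div_iff₀ hδ).2 ht)]
    rw [Real.div_rpow (by linarith) hδ.le,
      mul_div_cancel₀ _ (Real.rpow_pos_of_pos hδ _).ne']
  · exact mul_nonneg (Real.rpow_nonneg hδ.le _) (hnn _)
  have hG1 : Differentiable ℝ G := hG.differentiable (by simp)
  have hG2 : Differentiable ℝ (deriv G) :=
    (contDiff_infty_iff_deriv.1 hG).2.differentiable (by simp)
  have hdiv : ∀ x : ℝ, HasDerivAt (fun t : ℝ => t / δ) (1 / δ) x :=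
    fun x => (hasDerivAt_id x).div_const δ
  have hd1 : deriv (fun t => δ ^ (1 + ε) * G (t / δ)) = fun t => δ ^ ε * deriv G (t / δ) := by
    funext x
    have h : HasDerivAt (fun t => G (t / δ)) _ x := (hG1 _).hasDerivAt.comp x (hdiv x)
    rw [(h.const_mul _).deriv, Real.rpow_add hδ, Real.rpow_one]
    field_simp
  have hd2 : deriv (fun t => δ ^ ε * deriv G (t / δ)) t =
      δ ^ (-1 + ε) * deriv (deriv G) (t / δ) := by
    have h : HasDerivAt (fun t => deriv G (t / δ)) _ t := (hG2 _).hasDerivAt.comp t (hdiv t)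
    rw [(h.const_mul _).deriv, Real.rpow_add hδ, Real.rpow_neg_one]
    field_simp
  have hscale : ∀ a : ℝ, δ ^ a * (A * (t / δ) ^ a) = A * t ^ a := fun a => by
    have := (Real.rpow_pos_of_pos hδ a).ne'
    rw [Real.div_rpow ht.le hδ.le]
    field_simp
  obtain ⟨b1, b2⟩ := hb (t / δ) (by positivity)
  rw [hd1, hd2, abs_mul, abs_mul, abs_of_pos (Real.rpow_pos_of_pos hδ _),
    abs_of_pos (Real.rpow_pos_of_pos hδ _), ← hscale, ← hscale (-1 + ε)]
  constructor <;> gcongr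

lemma fderiv_fderiv_comp_apply {E : Type*} [NormedAddCommGroup E] [NormedSpace ℝ E] {ρ : E → ℝ}
    {g : ℝ → ℝ} {z : E} (hρ : ContDiffAt ℝ 2 ρ z) (hg : ContDiff ℝ 2 g) (v : E) :
    fderiv ℝ (fderiv ℝ fun w => g (ρ w)) z v v =
      deriv (deriv g) (ρ z) * fderiv ℝ ρ z v ^ 2 + deriv g (ρ z) * fderiv ℝ (fderiv ℝ ρ) z v v := by
  have hg1 : Differentiable ℝ g := hg.differentiable two_ne_zero
  have hg2 : Differentiable ℝ (deriv g) :=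
    ((contDiff_succ_iff_deriv (n := 1)).1 hg).2.2.differentiable one_ne_zero
  have h1 : fderiv ℝ (fun w => g (ρ w)) =ᶠ[𝓝 z] fun w => deriv g (ρ w) • fderiv ℝ ρ w := by
    filter_upwards [hρ.eventually (by simp)] with w hw
    exact ((hg1 _).hasDerivAt.comp_hasFDerivAt w
      (hw.differentiableAt two_ne_zero).hasFDerivAt).fderiv
  have h2 : HasFDerivAt (fderiv ℝ ρ) (fderiv ℝ (fderiv ℝ ρ) z) z :=
    ((hρ.fderiv_right (m := 1) (by norm_num)).differentiableAt one_ne_zero).hasFDerivAt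
  have h3 : HasFDerivAt (fun w => deriv g (ρ w)) (deriv (deriv g) (ρ z) • fderiv ℝ ρ z) z :=
    (hg2 _).hasDerivAt.comp_hasFDerivAt z (hρ.differentiableAt two_ne_zero).hasFDerivAt
  have h4 : HasFDerivAt (fun w => deriv g (ρ w) • fderiv ℝ ρ w) _ z := h3.smul h2
  rw [h1.fderiv_eq, h4.fderiv]
  simp
  ring

lemma abs_laplacian_comp_le {E : Type*} [NormedAddCommGroup E] [InnerProductSpace ℝ E]
    [FiniteDimensional ℝ E] {ρ : E → ℝ} {g : ℝ → ℝ} {z : E} (hρ : ContDiffAt ℝ 2 ρ z)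
    (hg : ContDiff ℝ 2 g) :
    |(Laplacian.laplacian (fun w => g (ρ w)) : E → ℝ) z| ≤
      Module.finrank ℝ E * (|deriv (deriv g) (ρ z)| * ‖fderiv ℝ ρ z‖ ^ 2 +
        |deriv g (ρ z)| * ‖fderiv ℝ (fderiv ℝ ρ) z‖) := by
  rw [InnerProductSpace.laplacian_eq_iteratedFDeriv_orthonormalBasis _ (stdOrthonormalBasis ℝ E)]
  simp only [iteratedFDeriv_two_apply, Matrix.cons_val_zero, Matrix.cons_val_one]
  refine (Finset.abs_sum_le_sum_abs _ _).trans ?_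
  refine (Finset.sum_le_card_nsmul _ _ (|deriv (deriv g) (ρ z)| * ‖fderiv ℝ ρ z‖ ^ 2 +
        |deriv g (ρ z)| * ‖fderiv ℝ (fderiv ℝ ρ) z‖) fun i _ => ?_).trans (by simp [mul_add])
  set e := stdOrthonormalBasis ℝ E i with he
  have hne : ‖e‖ = 1 := (stdOrthonormalBasis ℝ E).norm_eq_one i
  rw [fderiv_fderiv_comp_apply hρ hg]
  refine (abs_add_le _ _).trans ?_
  rw [abs_mul, abs_mul, abs_pow]
  have b1 : |fderiv ℝ ρ z e| ≤ ‖fderiv ℝ ρ z‖ := by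
    simpa [hne] using (fderiv ℝ ρ z).le_opNorm e
  have b2 : |fderiv ℝ (fderiv ℝ ρ) z e e| ≤ ‖fderiv ℝ (fderiv ℝ ρ) z‖ := by
    simpa [hne] using (fderiv ℝ (fderiv ℝ ρ) z).le_opNorm₂ e e
  gcongr

lemma EReal.ofReal_abs_toReal_le_abs (x : EReal) : ENNReal.ofReal |x.toReal| ≤ x.abs := by
  induction x with
  | bot => simp
  | top => simp
  | coe x => rw [EReal.toReal_coe, EReal.abs_def]

section Weight

variable {n : ℕ} {Ω : Set (EuclideanSpace ℂ (Fin n))}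

/-- Cut-offs of the weight `(-r) ^ (1 + ε)` are test functions whose Laplacians are bounded by
a constant multiple of `(-r) ^ (-1 + ε)`, uniformly in the cut-off level `δ`. -/
lemma IsSmoothDefiningFunction.exists_test_functions (hΩ : IsOpen Ω)
    (hΩ_bdd : Bornology.IsBounded Ω) {r : EuclideanSpace ℂ (Fin n) → ℝ}
    (hr : IsSmoothDefiningFunction Ω r) {ε : ℝ} (hε : 0 < ε) :
    ∃ C : ℝ, 0 ≤ C ∧ ∀ δ : ℝ, 0 < δ → ∃ φ : EuclideanSpace ℂ (Fin n) → ℝ,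
      IsTestFunctionOn φ Ω ∧ (∀ z, 0 ≤ φ z) ∧
      (∀ z ∈ Ω, 2 * δ ≤ -r z → φ z = (-r z) ^ (1 + ε)) ∧
      ∀ z ∈ Ω, |(Laplacian.laplacian φ : EuclideanSpace ℂ (Fin n) → ℝ) z| ≤
        C * (-r z) ^ (-1 + ε) := by
  classical
  obtain ⟨U, hU, hΩU, hrU, hΩr, hfr⟩ := hr
  have hcpt : IsCompact (closure Ω) := hΩ_bdd.isCompact_closure
  set ρ : EuclideanSpace ℂ (Fin n) → ℝ := fun z => -r z with hρ
  have hρU : ContDiffOn ℝ ∞ ρ U := hrU.neg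
  have hpos : ∀ z ∈ Ω, 0 < ρ z := fun z hz => by
    rw [hΩr] at hz
    exact neg_pos.2 hz.2
  have hat : ∀ z ∈ closure Ω, ContDiffAt ℝ ∞ ρ z :=
    fun z hz => hρU.contDiffAt (hU.mem_nhds (hΩU hz))
  obtain ⟨R, hR⟩ := hcpt.exists_bound_of_continuousOn (f := ρ)
    fun z hz => (hat z hz).continuousAt.continuousWithinAt
  obtain ⟨D₁, hD₁⟩ := hcpt.exists_bound_of_continuousOn (f := fderiv ℝ ρ)
    fun z hz => ((hat z hz).fderiv_right (m := 0) (by simp)).continuousAt.continuousWithinAt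
  obtain ⟨D₂, hD₂⟩ := hcpt.exists_bound_of_continuousOn (f := fderiv ℝ (fderiv ℝ ρ))
    fun z hz => (((contDiffAt_infty.1 (hat z hz) 2).fderiv_right (m := 1) (by norm_num)).fderiv_right
      (m := 0) (by simp)).continuousAt.continuousWithinAt
  obtain ⟨A, hA, hcut⟩ := exists_smooth_cutoff_rpow hε
  set N : ℝ := (Module.finrank ℝ (EuclideanSpace ℂ (Fin n)) : ℝ) with hN
  have hN0 : 0 ≤ N := Nat.cast_nonneg _
  refine ⟨N * A * (D₁ ^ 2 + |R| * |D₂|), by positivity, fun δ hδ => ?_⟩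
  obtain ⟨g, hg, hg0, hg2, hgnn, hgb⟩ := hcut δ hδ
  set φ : EuclideanSpace ℂ (Fin n) → ℝ := fun z => if z ∈ Ω then g (ρ z) else 0 with hφ
  have hφΩ : ∀ z ∈ Ω, φ =ᶠ[𝓝 z] fun w => g (ρ w) := fun z hz => by
    filter_upwards [hΩ.mem_nhds hz] with w hw
    simp [hφ, hw]
  -- The sublevel sets of `r` at negative levels are compact because `r = 0` on the boundary.
  set K : Set (EuclideanSpace ℂ (Fin n)) := closure Ω ∩ ρ ⁻¹' Ici δ with hK
  have hKclosed : IsClosed K := ContinuousOn.preimage_isClosed_of_isClosed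
    (fun z hz => (hat z hz).continuousAt.continuousWithinAt) isClosed_closure isClosed_Ici
  have hKcpt : IsCompact K := hcpt.of_isClosed_subset hKclosed inter_subset_left
  have hKΩ : K ⊆ Ω := by
    rintro z ⟨hz, hzδ⟩
    by_contra hzΩ
    have h := (hfr z ⟨hz, by rwa [hΩ.interior_eq]⟩).1
    have hzδ' : δ ≤ -r z := hzδ
    linarith
  have hφK : ∀ z ∉ K, φ z = 0 := fun z hz => by
    by_cases hzΩ : z ∈ Ω
    · have : ρ z < δ := by
        by_contra! h
        exact hz ⟨subset_closure hzΩ, h⟩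
      simp [hφ, hg0 _ this.le]
    · simp [hφ, hzΩ]
  have hts : tsupport φ ⊆ K := closure_minimal (fun z hz => by
    by_contra h
    exact hz (hφK z h)) hKclosed
  refine ⟨φ, ⟨?_, hKcpt.of_isClosed_subset (isClosed_tsupport _) hts, hts.trans hKΩ⟩,
    fun z => ?_, fun z hz h => ?_, fun z hz => ?_⟩
  · rw [contDiff_iff_contDiffAt]
    intro z
    by_cases hz : z ∈ K
    · refine ContDiffAt.congr_of_eventuallyEq ?_ (hφΩ z (hKΩ hz))
      exact hg.contDiffAt.comp z (hat z hz.1)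
    · have : φ =ᶠ[𝓝 z] fun _ => 0 := by
        filter_upwards [hKclosed.isOpen_compl.mem_nhds hz] with w hw using hφK w hw
      exact contDiffAt_const.congr_of_eventuallyEq this
  · simp only [hφ]
    split_ifs
    exacts [hgnn _, le_rfl]
  · simp only [hφ, if_pos hz]
    exact hg2 _ h
  · have hzc := subset_closure hz
    have hρz := hpos z hz
    rw [(InnerProductSpace.laplacian_congr_nhds (hφΩ z hz)).self_of_nhds]
    refine (abs_laplacian_comp_le (contDiffAt_infty.1 (hat z hzc) 2)
      (contDiff_infty.1 hg 2)).trans ?_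
    obtain ⟨b1, b2⟩ := hgb (ρ z) hρz
    have hsplit : ρ z ^ ε = ρ z * ρ z ^ (-1 + ε) := by
      rw [Real.rpow_add hρz, Real.rpow_neg_one, mul_inv_cancel_left₀ hρz.ne']
    have hRz : ρ z ≤ |R| := (le_abs_self _).trans ((hR z hzc).trans (le_abs_self R))
    have hp : 0 < ρ z ^ (-1 + ε) := Real.rpow_pos_of_pos hρz _
    calc _ ≤ N * ((A * ρ z ^ (-1 + ε)) * D₁ ^ 2 + (A * (|R| * ρ z ^ (-1 + ε))) * |D₂|) := by
          have b1' : |deriv g (ρ z)| ≤ A * (|R| * ρ z ^ (-1 + ε)) := by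
            refine b1.trans ?_
            rw [hsplit]
            gcongr
          have b3 := hD₁ z hzc
          have b4 := (hD₂ z hzc).trans (le_abs_self D₂)
          gcongr
      _ = N * A * (D₁ ^ 2 + |R| * |D₂|) * ρ z ^ (-1 + ε) := by ring

/-- Testing the Riesz measure with `φ ≥ 0`, when `|Δφ|` is bounded by a weight `w` up to a constant. -/
lemma IsRieszMeasure.lintegral_le_of_abs_laplacian_le {u : EuclideanSpace ℂ (Fin n) → EReal}
    {μ : Measure (EuclideanSpace ℂ (Fin n))} (hμ : IsRieszMeasure Ω u μ) (hΩ : IsOpen Ω)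
    {φ : EuclideanSpace ℂ (Fin n) → ℝ} (hφ : IsTestFunctionOn φ Ω) (hφ0 : ∀ z, 0 ≤ φ z)
    {C : ℝ} (hC : 0 ≤ C) {w : EuclideanSpace ℂ (Fin n) → ℝ}
    (hb : ∀ z ∈ Ω, |(Laplacian.laplacian φ : EuclideanSpace ℂ (Fin n) → ℝ) z| ≤ C * w z) :
    ∫⁻ z in Ω, ENNReal.ofReal (φ z) ∂μ ≤
      ENNReal.ofReal C * ∫⁻ z in Ω, ENNReal.ofReal (w z) * (u z).abs := by
  have hcont := hφ.contDiff.continuous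
  have hint : Integrable φ μ := by
    have h1 : IntegrableOn φ (tsupport φ) μ := by
      obtain ⟨B, hB⟩ := hφ.hasCompactSupport.exists_bound_of_continuous hcont
      exact Measure.integrableOn_of_bounded
        (hμ.lt_top_of_isCompact _ hφ.tsupport_subset hφ.hasCompactSupport).ne
        hcont.aestronglyMeasurable (Eventually.of_forall hB)
    exact h1.integrable_of_forall_notMem_eq_zero fun z hz => image_eq_zero_of_notMem_tsupport hz
  calc ∫⁻ z in Ω, ENNReal.ofReal (φ z) ∂μ ≤ ∫⁻ z, ENNReal.ofReal (φ z) ∂μ :=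
        setLIntegral_le_lintegral _ _
    _ = ENNReal.ofReal (∫ z, φ z ∂μ) :=
        (ofReal_integral_eq_lintegral_ofReal hint (Eventually.of_forall hφ0)).symm
    _ ≤ ‖∫ z in Ω, (u z).toReal *
          (Laplacian.laplacian φ : EuclideanSpace ℂ (Fin n) → ℝ) z‖ₑ := by
        rw [hμ.integral_eq φ hφ.contDiff hφ.hasCompactSupport hφ.tsupport_subset,
          Real.enorm_eq_ofReal_abs]
        exact ENNReal.ofReal_le_ofReal (le_abs_self _)
    _ ≤ ∫⁻ z in Ω, ‖(u z).toReal *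
          (Laplacian.laplacian φ : EuclideanSpace ℂ (Fin n) → ℝ) z‖ₑ :=
        enorm_integral_le_lintegral_enorm _
    _ ≤ ∫⁻ z in Ω, ENNReal.ofReal C * (ENNReal.ofReal (w z) * (u z).abs) := by
        refine setLIntegral_mono' hΩ.measurableSet fun z hz => ?_
        rw [enorm_mul, Real.enorm_eq_ofReal_abs, Real.enorm_eq_ofReal_abs, ← mul_assoc,
          ← ENNReal.ofReal_mul hC, mul_comm]
        exact mul_le_mul' (ENNReal.ofReal_le_ofReal (hb z hz)) (EReal.ofReal_abs_toReal_le_abs _)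
    _ = _ := lintegral_const_mul' _ _ ENNReal.ofReal_ne_top

end Weight

theorem theorem3p2 (n : ℕ) (Ω : Set (EuclideanSpace ℂ (Fin n))) (hΩ_open : IsOpen Ω)
    (hΩ_conn : IsConnected Ω) (hΩ_bdd : Bornology.IsBounded Ω)
    (r : EuclideanSpace ℂ (Fin n) → ℝ) (hr : IsSmoothDefiningFunction Ω r)
    (ε : ℝ) (hε : 0 < ε) :
    ∃ C : ℝ≥0, ∀ u : EuclideanSpace ℂ (Fin n) → EReal,
      IsPlurisubharmonicOn u Ω → (∃ z ∈ Ω, u z ≠ ⊥) →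
        (∃ μ : Measure (EuclideanSpace ℂ (Fin n)), IsRieszMeasure Ω u μ) ∧
        ∀ μ : Measure (EuclideanSpace ℂ (Fin n)), IsRieszMeasure Ω u μ →
          ∫⁻ z in Ω, ENNReal.ofReal ((-r z) ^ (1 + ε)) ∂μ ≤
            C * ∫⁻ z in Ω, ENNReal.ofReal ((-r z) ^ (-1 + ε)) * (u z).abs := by
  obtain ⟨C, hC, hφ⟩ := hr.exists_test_functions hΩ_open hΩ_bdd hε
  refine ⟨C.toNNReal, fun u hu hne =>
    ⟨hu.exists_isRieszMeasure hΩ_open hΩ_conn.isPreconnected hne, fun μ hμ => ?_⟩⟩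
  choose! φ hφt hφ0 hφr hφb using hφ
  have hk : ∀ k : ℕ, (0 : ℝ) < 1 / ((k : ℝ) + 1) := fun k => Nat.one_div_pos_of_nat
  have hpos : ∀ z ∈ Ω, 0 < -r z := fun z hz => by
    obtain ⟨U, -, -, -, hΩr, -⟩ := hr
    rw [hΩr] at hz
    exact neg_pos.2 hz.2
  calc ∫⁻ z in Ω, ENNReal.ofReal ((-r z) ^ (1 + ε)) ∂μ
      = ∫⁻ z in Ω, liminf (fun k : ℕ => ENNReal.ofReal (φ (1 / ((k : ℝ) + 1)) z)) atTop ∂μ := by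
        refine setLIntegral_congr_fun hΩ_open.measurableSet fun z hz => ?_
        refine (Tendsto.liminf_eq ?_).symm
        refine tendsto_const_nhds.congr' ?_
        have hlim : Tendsto (fun k : ℕ => 2 * (1 / ((k : ℝ) + 1))) atTop (𝓝 0) := by
          simpa using tendsto_one_div_add_atTop_nhds_zero_nat.const_mul (2 : ℝ)
        filter_upwards [hlim.eventually (eventually_le_nhds (hpos z hz))] with k hkz
        rw [hφr _ (hk k) z hz hkz]
    _ ≤ liminf (fun k : ℕ => ∫⁻ z in Ω, ENNReal.ofReal (φ (1 / ((k : ℝ) + 1)) z) ∂μ) atTop :=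
        lintegral_liminf_le fun k =>
          (hφt _ (hk k)).contDiff.continuous.measurable.ennreal_ofReal
    _ ≤ C.toNNReal * ∫⁻ z in Ω, ENNReal.ofReal ((-r z) ^ (-1 + ε)) * (u z).abs := by
        refine liminf_le_of_le (by isBoundedDefault) fun a ha => ?_
        obtain ⟨k, hak⟩ := ha.exists
        exact hak.trans (hμ.lintegral_le_of_abs_laplacian_le hΩ_open (hφt _ (hk k)) (hφ0 _ (hk k)) hC
          (hφb _ (hk k)))
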